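/- **Setting.** Let $g_{12},g_{21},g_{10},g_{20}>0$ be the amplitude gains of the links user 1→user 2, user 2→user 1, user 1→destination and user 2→destination in a Gaussian multiple access channel with unit noise, let $P_1,P_2>0$ be the powers, and let $C(x)=\log_2(1+x)$. In the three-phase half-duplex scheme with phase durations $\alpha_1,\alpha_2\ge 0$, $\alpha_3=1-\alpha_1-\alpha_2\ge 0$, user $i$ splits its message as $w_1=(w_{10},w_{12})$, $w_2=(w_{20},w_{21})$. With unit-power Gaussian codewords $U_1,U_2,U_3,V_1,V_2$, it transmits $X_{11}=\sqrt{\rho_{11}}U_1(w_{12})$ (user 1, phase 1), $X_{22}=\sqrt{\rho_{22}}U_2(w_{21})$ (user 2, phase 2), and in phase 3 $X_{13}=\sqrt{\rho_{10}}V_1(w_{10})+\sqrt{\rho_{13}}U_3(w_{12},w_{21})$ (user 1), $X_{23}=\sqrt{\rho_{20}}V_2(w_{20})+\sqrt{\rho_{23}}U_3(w_{12},w_{21})$ (user 2). The powers are nonnegative with $\alpha_1\rho_{11}+\alpha_3(\rho_{10}+\rho_{13})=P_1$ and $\alpha_2\rho_{22}+\alpha_3(\rho_{20}+\rho_{23})=P_2$.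 User 2 decodes $w_{12}$ after phase 1, user 1 decodes $w_{21}$ after phase 2, and the destination decodes everything jointly at the end of phase 3 from what it received in all phases. Put $\zeta=g_{10}^2(\rho_{10}+\rho_{13})+g_{20}^2(\rho_{20}+\rho_{23})+2g_{10}g_{20}\sqrt{\rho_{13}\rho_{23}}$, $I_1=\alpha_1C(g_{12}^2\rho_{11})$, $I_2=\alpha_2C(g_{21}^2\rho_{22})$, $I_3=\alpha_3C(g_{10}^2\rho_{10})$, $I_4=\alpha_3C(g_{20}^2\rho_{20})$, $I_5=\alpha_3C(g_{10}^2\rho_{10}+g_{20}^2\rho_{20})$, $I_6=\alpha_1C(g_{10}^2\rho_{11})+\alpha_3C(\zeta)$, $I_7=\alpha_2C(g_{20}^2\rho_{22})+\alpha_3C(\zeta)$, $I_8=I_6+\alpha_2C(g_{20}^2\rho_{22})$. Decodability of the parts means $R_{12}\le I_1$, $R_{21}\le I_2$, $R_{10}\le I_3$, $R_{20}\le I_4$, $R_{10}+R_{20}\le I_5$, $R_1+R_{20}\le I_6$, $R_{10}+R_2\le I_7$, $R_1+R_2\le I_8$, where $R_1=R_{10}+R_{12}$ and $R_2=R_{20}+R_{21}$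 are the rates of $w_1$ and $w_2$. The rate region is given by $R_1,R_2\ge0$, $R_1\le J_1=I_1+I_3$, $R_2\le I_2+I_4$ and $R_1+R_2\le\min\{I_1+I_2+I_5,\ I_2+I_6,\ I_1+I_7,\ S_4\}$ with $S_4=I_8$. The individual rate is the largest $R_1$ with $(R_1,0)$ in this region. **Case 1: $g_{12}<g_{10}$.** The largest individual rate over all phase durations and powers is $C(g_{10}^2P_1)$, and this stays so if user 2 spends any power $Q\in[0,P_2]$ instead of $P_2$. It is reached only with $\alpha_1=\alpha_2=0$, $\rho_{10}=P_1$, $\rho_{13}=0$, and it is reached by direct transmission: user 1 sends $w_1=w_{10}$ during the whole time and user 2 stays silent. **Otherwise, $g_{12}\ge g_{10}$; fix $\alpha_1=\alpha\in(0,1)$.** The largest individual rate over the three-phase scheme with $\alpha_1=\alpha$ is attained with $\alpha_2=0$, $\rho_{22}=\rho_{20}=0$, $\rho_{23}=P_2/(1-\alpha)$, and so equals the value of the problem: maximize $R$ subject to $R\le J_1$, $R\le S_4$, $\alpha\rho_{11}+(1-\alpha)(\rho_{10}+\rho_{13})=P_1$, $\rho_{10},\rho_{11},\rho_{13}\ge0$.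 This problem has exactly one solution $(R,\rho_{10},\rho_{11},\rho_{13})$. A point is the solution if and only if it satisfies the KKT conditions for some multipliers $\lambda_0,\lambda_1,\lambda_2\ge0$ (of $R\le J_1$, of $R\le S_4$, and of the power equality) and $\mu_{10},\mu_{11},\mu_{13}\ge0$ (of $\rho_i\ge0$). For any such multipliers exactly one of the following four cases holds. Write $a_1=g_{10}^{-2}-g_{12}^{-2}$, $a_2=g_{10}^{-2}+\rho_{11}$, $a_3=g_{12}^{-2}+\rho_{11}$, $a_4=1+\frac{g_{20}}{g_{10}}\sqrt{\rho_{23}/\rho_{13}}$, $a_5=\rho_{13}+\frac{g_{20}^2}{g_{10}^2}\rho_{23}+2\frac{g_{20}}{g_{10}}\sqrt{\rho_{13}\rho_{23}}$. * **Case 2.a: $\lambda_1>0$, $\mu_{10}=0$.** Then $\lambda_0>0$, $R=J_1=S_4$, $\rho_{13}>0$, and $\rho_{11}=(2a_4)^{-1}\big(b_1+\sqrt{b_1^2-4a_4b_2}\big)-g_{10}^{-2}$, $\ \rho_{10}=(a_4-1+a_3/a_2)^{-1}\big(a_4a_3-(a_3/a_2)a_5\big)-g_{10}^{-2}$, with $b_1=a_4(P_1+g_{10}^{-2}-(1-\alpha)\rho_{13})+\alpha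 a_1+(1-\alpha)(a_4a_1+a_5)$ and $b_2=a_1P_1+(1-\alpha)a_1\frac{g_{20}^2}{g_{10}^2}\rho_{23}+g_{10}^{-2}a_1+2(1-\alpha)a_1\frac{g_{20}}{g_{10}}\sqrt{\rho_{13}\rho_{23}}$. With these expressions for $\rho_{11}$ and $\rho_{10}$ in terms of $\rho_{13}$, the power $\rho_{13}$ is a root of $f_2=\frac{P_1-\alpha\rho_{11}}{1-\alpha}-\rho_{13}-g_{10}^{-2}\big(2^{f_1/(1-\alpha)}-1\big)$, where $f_1=\alpha C(g_{10}^2\rho_{11})+(1-\alpha)C(g_{10}^2(\rho_{10}+a_5))-\alpha C(g_{12}^2\rho_{11})$. The optimal scheme is partial decode-forward with message repetition: user 1 sends $w_{12}$ in phase 1, user 2 decodes it, and in phase 3 user 1 sends $(w_{10},w_{12})$ and user 2 sends $w_{12}$. (In the degenerate event $\rho_{10}=0$ it is decode-forward, as in Case 2.b.) * **Case 2.b: $\lambda_1>0$, $\mu_{10}>0$.** Then $R=S_4$, $\rho_{10}=0$, $\rho_{13}>0$ and $\rho_{11}=\alpha^{-1}(P_1-(1-\alpha)\rho_{13})$. If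 $\lambda_0>0$, then also $R=J_1$ and $\rho_{13}$ is a root of $f_4=\frac{P_1-(1-\alpha)\rho_{13}}{\alpha}-g_{10}^{-2}\Big(\frac{1-g_{12}^2g_{10}^{-2}}{2^{f_3}-g_{12}^2g_{10}^{-2}}-1\Big)$ with $f_3=\frac{1-\alpha}{\alpha}C(g_{10}^2a_5)$. If $\lambda_0=0$, then $a_4a_2=g_{10}^{-2}+a_5$. The optimal scheme is decode-forward: user 1 sends $w_1=w_{12}$ in phase 1, user 2 decodes it, and both users send $w_1$ in phase 3. * **Case 3.a: $\lambda_1=0$, $\mu_{10}=0$.** Then $\lambda_0>0$, $\mu_{13}>0$, $R=J_1$, $\rho_{13}=0$, $\rho_{11}=P_1+(1-\alpha)a_1$, $\rho_{10}=P_1-\alpha a_1$. The optimal scheme is partial decode-forward without message repetition: user 1 sends $w_{12}$ in phase 1, user 2 decodes it, and in phase 3 user 1 sends $w_{10}$ and user 2 sends $w_{12}$. (In the degenerate event $\rho_{10}=0$ it is two-hop transmission, as in Case 3.b.) * **Case 3.b: $\lambda_1=0$, $\mu_{10}>0$.** Then $\lambda_0>0$, $\mu_{13}>0$, $R=J_1$,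 $\rho_{13}=\rho_{10}=0$, $\rho_{11}=P_1/\alpha$. The optimal scheme is two-hop transmission: user 1 sends $w_1=w_{12}$ in phase 1, user 2 decodes it, and in phase 3 user 2 sends $w_1$ while user 1 stays silent. If $J_1=S_4$ holds for no valid power allocation of the problem, then Case 3.a or 3.b holds. -/

import Mathlib

namespace RelayMAC

noncomputable section

/-- `C(x) = log₂(1 + x)`, rates being measured in bits per channel use. -/
def cap (x : ℝ) : ℝ := Real.logb 2 (1 + x)

/-- Amplitude gains of the links user 1 → user 2, user 2 → user 1, user 1 → destination and
user 2 → destination. -/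
structure Gains where
  g12 : ℝ
  g21 : ℝ
  g10 : ℝ
  g20 : ℝ

/-- All links are present. -/
def Gains.Pos (g : Gains) : Prop := 0 < g.g12 ∧ 0 < g.g21 ∧ 0 < g.g10 ∧ 0 < g.g20

/-! ### The three-phase scheme -/

/-- Phase durations and powers of the three-phase scheme, with transmit signals
* phase 1, user 1: `X₁₁ = √ρ11 U₁(w12)`;
* phase 2, user 2: `X₂₂ = √ρ22 U₂(w21)`;
* phase 3, user 1: `X₁₃ = √ρ10 V₁(w10) + √ρ13 U₃(w12, w21)`;
* phase 3, user 2: `X₂₃ = √ρ20 V₂(w20) + √ρ23 U₃(w12, w21)`. -/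
structure Design where
  α1 : ℝ
  α2 : ℝ
  ρ10 : ℝ
  ρ20 : ℝ
  ρ11 : ℝ
  ρ22 : ℝ
  ρ13 : ℝ
  ρ23 : ℝ

namespace Design

/-- Duration of the third phase. -/
def α3 (d : Design) : ℝ := 1 - d.α1 - d.α2

/-- Admissible durations and powers, user 1 spending average power `p1` and user 2 spending
average power `p2`. -/
def Feasible (d : Design) (p1 p2 : ℝ) : Prop :=
  0 ≤ d.α1 ∧ 0 ≤ d.α2 ∧ d.α1 + d.α2 ≤ 1 ∧
  0 ≤ d.ρ10 ∧ 0 ≤ d.ρ20 ∧ 0 ≤ d.ρ11 ∧ 0 ≤ d.ρ22 ∧ 0 ≤ d.ρ13 ∧ 0 ≤ d.ρ23 ∧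
  d.α1 * d.ρ11 + d.α3 * (d.ρ10 + d.ρ13) = p1 ∧
  d.α2 * d.ρ22 + d.α3 * (d.ρ20 + d.ρ23) = p2

/-- Received signal power at the destination in the third phase. -/
def ζ (g : Gains) (d : Design) : ℝ :=
  g.g10 ^ 2 * (d.ρ10 + d.ρ13) + g.g20 ^ 2 * (d.ρ20 + d.ρ23)
    + 2 * g.g10 * g.g20 * √(d.ρ13 * d.ρ23)

def I1 (g : Gains) (d : Design) : ℝ := d.α1 * cap (g.g12 ^ 2 * d.ρ11)
def I2 (g : Gains) (d : Design) : ℝ := d.α2 * cap (g.g21 ^ 2 * d.ρ22)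
def I3 (g : Gains) (d : Design) : ℝ := d.α3 * cap (g.g10 ^ 2 * d.ρ10)
def I4 (g : Gains) (d : Design) : ℝ := d.α3 * cap (g.g20 ^ 2 * d.ρ20)
def I5 (g : Gains) (d : Design) : ℝ := d.α3 * cap (g.g10 ^ 2 * d.ρ10 + g.g20 ^ 2 * d.ρ20)
def I6 (g : Gains) (d : Design) : ℝ := d.α1 * cap (g.g10 ^ 2 * d.ρ11) + d.α3 * cap (d.ζ g)
def I7 (g : Gains) (d : Design) : ℝ := d.α2 * cap (g.g20 ^ 2 * d.ρ22) + d.α3 * cap (d.ζ g)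
def I8 (g : Gains) (d : Design) : ℝ :=
  d.α1 * cap (g.g10 ^ 2 * d.ρ11) + d.α2 * cap (g.g20 ^ 2 * d.ρ22) + d.α3 * cap (d.ζ g)

def J1 (g : Gains) (d : Design) : ℝ := d.I1 g + d.I3 g
def J2 (g : Gains) (d : Design) : ℝ := d.I2 g + d.I4 g
def S1 (g : Gains) (d : Design) : ℝ := d.I1 g + d.I2 g + d.I5 g
def S2 (g : Gains) (d : Design) : ℝ := d.I2 g + d.I6 g
def S3 (g : Gains) (d : Design) : ℝ := d.I1 g + d.I7 g
def S4 (g : Gains) (d : Design) : ℝ := d.I8 g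

/-- The rate pair `(R1, R2)` lies in the rate region of the scheme with parameters `d`. -/
def InRegion (g : Gains) (d : Design) (R1 R2 : ℝ) : Prop :=
  0 ≤ R1 ∧ 0 ≤ R2 ∧ R1 ≤ d.J1 g ∧ R2 ≤ d.J2 g ∧ R1 + R2 ≤ d.S1 g ∧ R1 + R2 ≤ d.S2 g ∧
  R1 + R2 ≤ d.S3 g ∧ R1 + R2 ≤ d.S4 g

end Design

/-- Individual rates `R1` (with `R2 = 0`) of the scheme over all phase durations and powers. -/
def individualRates (g : Gains) (p1 p2 : ℝ) : Set ℝ :=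
  {R | ∃ d : Design, d.Feasible p1 p2 ∧ d.InRegion g R 0}

/-- Individual rates `R1` (with `R2 = 0`) of the scheme with first phase of duration `α`. -/
def individualRatesAt (g : Gains) (p1 p2 α : ℝ) : Set ℝ :=
  {R | ∃ d : Design, d.α1 = α ∧ d.Feasible p1 p2 ∧ d.InRegion g R 0}

/-! ### Messages and transmission schemes -/

/-- The private parts `w10`, `w20` and the cooperative parts `w12`, `w21` of
`w1 = (w10, w12)` and `w2 = (w20, w21)`. -/
inductive MessagePart
  | w10 | w12 | w20 | w21

/-- Rates of the four message parts; a part of rate zero is empty. -/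
structure RateSplit where
  R10 : ℝ
  R12 : ℝ
  R20 : ℝ
  R21 : ℝ

def RateSplit.rate (s : RateSplit) : MessagePart → ℝ
  | .w10 => s.R10
  | .w12 => s.R12
  | .w20 => s.R20
  | .w21 => s.R21

/-- Decoding conditions: user 2 decodes `w12` after phase 1, user 1 decodes `w21` after phase 2, and
the destination jointly decodes everything at the end of phase 3 from what it received in all
phases. -/
def Decodable (g : Gains) (d : Design) (s : RateSplit) : Prop :=
  0 ≤ s.R10 ∧ 0 ≤ s.R12 ∧ 0 ≤ s.R20 ∧ 0 ≤ s.R21 ∧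
  s.R12 ≤ d.I1 g ∧ s.R21 ≤ d.I2 g ∧
  s.R10 ≤ d.I3 g ∧ s.R20 ≤ d.I4 g ∧ s.R10 + s.R20 ≤ d.I5 g ∧
  (s.R10 + s.R12) + s.R20 ≤ d.I6 g ∧ s.R10 + (s.R20 + s.R21) ≤ d.I7 g ∧
  (s.R10 + s.R12) + (s.R20 + s.R21) ≤ d.I8 g

/-- The split `s` delivers user 1's message at total rate `R`, user 2 having no message. -/
def Delivers (g : Gains) (d : Design) (R : ℝ) (s : RateSplit) : Prop :=
  Decodable g d s ∧ s.R10 + s.R12 = R ∧ s.R20 = 0 ∧ s.R21 = 0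

/-- Nonempty message parts sent by user 1 in phase 1. -/
def sent11 (d : Design) (s : RateSplit) : Set MessagePart :=
  {m | 0 < s.rate m ∧ 0 < d.α1 ∧ m = .w12 ∧ 0 < d.ρ11}

/-- Nonempty message parts sent by user 1 in phase 3. -/
def sent13 (d : Design) (s : RateSplit) : Set MessagePart :=
  {m | 0 < s.rate m ∧ 0 < d.α3 ∧
    ((m = .w10 ∧ 0 < d.ρ10) ∨ ((m = .w12 ∨ m = .w21) ∧ 0 < d.ρ13))}

/-- Nonempty message parts sent by user 2 in phase 3. -/
def sent23 (d : Design) (s : RateSplit) : Set MessagePart :=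
  {m | 0 < s.rate m ∧ 0 < d.α3 ∧
    ((m = .w20 ∧ 0 < d.ρ20) ∨ ((m = .w12 ∨ m = .w21) ∧ 0 < d.ρ23))}

/-- Direct transmission: user 1 sends `w1 = w10` all the time, user 2 is silent. -/
def IsDirect (d : Design) (s : RateSplit) : Prop :=
  d.α1 = 0 ∧ d.α2 = 0 ∧ s.R12 = 0 ∧ sent13 d s = {.w10} ∧
  d.ρ22 = 0 ∧ d.ρ20 = 0 ∧ d.ρ23 = 0

/-- Partial decode-forward with message repetition. -/
def IsPDFRepetition (d : Design) (s : RateSplit) : Prop :=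
  d.α2 = 0 ∧ sent11 d s = {.w12} ∧ sent13 d s = {.w10, .w12} ∧ sent23 d s = {.w12}

/-- Full decode-forward: `w1 = w12`, sent by user 1 in phase 1 and by both users in phase 3. -/
def IsDF (d : Design) (s : RateSplit) : Prop :=
  d.α2 = 0 ∧ s.R10 = 0 ∧ sent11 d s = {.w12} ∧ sent13 d s = {.w12} ∧ sent23 d s = {.w12}

/-- Partial decode-forward without message repetition. -/
def IsPDFNoRepetition (d : Design) (s : RateSplit) : Prop :=
  d.α2 = 0 ∧ sent11 d s = {.w12} ∧ sent13 d s = {.w10} ∧ sent23 d s = {.w12}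

/-- Two-hop transmission: `w1 = w12`, sent by user 1 in phase 1 and by user 2 in phase 3, where
user 1 is silent. -/
def IsTwoHop (d : Design) (s : RateSplit) : Prop :=
  d.α2 = 0 ∧ s.R10 = 0 ∧ sent11 d s = {.w12} ∧ d.ρ10 = 0 ∧ d.ρ13 = 0 ∧ sent23 d s = {.w12}

/-- The design `d` delivers rate `R`, and whatever rate split is used for that, it is a scheme of
kind `K`. -/
def UsesScheme (g : Gains) (d : Design) (R : ℝ) (K : Design → RateSplit → Prop) : Prop :=
  (∃ s, Delivers g d R s) ∧ ∀ s, Delivers g d R s → K d s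

/-! ### The relay optimization problem for fixed `α1` -/

/-- Power of user 2 in phase 3 when it spends all its power there. -/
def rho23 (P2 α : ℝ) : ℝ := P2 / (1 - α)

/-- Variables of the problem: the rate and the powers of user 1. -/
structure Point where
  R : ℝ
  ρ10 : ℝ
  ρ11 : ℝ
  ρ13 : ℝ

/-- The reduction of the scheme to two phases. -/
def relayDesign (P2 α : ℝ) (x : Point) : Design where
  α1 := α
  α2 := 0
  ρ10 := x.ρ10
  ρ20 := 0
  ρ11 := x.ρ11
  ρ22 := 0
  ρ13 := x.ρ13
  ρ23 := rho23 P2 α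

/-- `J₁` in the relay problem. -/
def Point.J1 (g : Gains) (P2 α : ℝ) (x : Point) : ℝ := (relayDesign P2 α x).J1 g

/-- `S₄` in the relay problem. -/
def Point.S4 (g : Gains) (P2 α : ℝ) (x : Point) : ℝ := (relayDesign P2 α x).S4 g

/-- The power allocation of `x` is valid. -/
def Point.ValidPower (P1 α : ℝ) (x : Point) : Prop :=
  α * x.ρ11 + (1 - α) * (x.ρ10 + x.ρ13) = P1 ∧ 0 ≤ x.ρ10 ∧ 0 ≤ x.ρ11 ∧ 0 ≤ x.ρ13

/-- `x` satisfies all constraints of the relay problem. -/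
def Point.Feasible (g : Gains) (P1 P2 α : ℝ) (x : Point) : Prop :=
  x.ValidPower P1 α ∧ x.R ≤ x.J1 g P2 α ∧ x.R ≤ x.S4 g P2 α

/-- `x` solves: maximize `R` subject to `R ≤ J₁`, `R ≤ S₄` and the power constraints. -/
def IsOptimal (g : Gains) (P1 P2 α : ℝ) (x : Point) : Prop :=
  x.Feasible g P1 P2 α ∧ ∀ y : Point, y.Feasible g P1 P2 α → y.R ≤ x.R

/-- Lagrange multipliers: of the two rate constraints, of the power equality and of the
non-negativity of the three powers. -/
structure Multipliers where
  lam0 : ℝ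
  lam1 : ℝ
  lam2 : ℝ
  mu10 : ℝ
  mu11 : ℝ
  mu13 : ℝ

/-- The Lagrangian of the relay problem as a function of `(R, ρ10, ρ11, ρ13)`. -/
def lagrangian (g : Gains) (P1 P2 α : ℝ) (m : Multipliers) (v : ℝ × ℝ × ℝ × ℝ) : ℝ :=
  let x : Point := ⟨v.1, v.2.1, v.2.2.1, v.2.2.2⟩
  x.R - m.lam0 * (x.R - x.J1 g P2 α) - m.lam1 * (x.R - x.S4 g P2 α)
    - m.lam2 * (α * x.ρ11 + (1 - α) * (x.ρ10 + x.ρ13) - P1)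
    + (m.mu10 * x.ρ10 + m.mu11 * x.ρ11 + m.mu13 * x.ρ13)

/-- The KKT conditions: stationarity (the Lagrangian is differentiable with zero derivative),
feasibility, signs of the multipliers, complementary slackness. -/
def IsKKT (g : Gains) (P1 P2 α : ℝ) (x : Point) (m : Multipliers) : Prop :=
  HasFDerivAt (lagrangian g P1 P2 α m) (0 : ℝ × ℝ × ℝ × ℝ →L[ℝ] ℝ) (x.R, x.ρ10, x.ρ11, x.ρ13) ∧
  x.Feasible g P1 P2 α ∧
  0 ≤ m.lam0 ∧ 0 ≤ m.lam1 ∧ 0 ≤ m.lam2 ∧ 0 ≤ m.mu10 ∧ 0 ≤ m.mu11 ∧ 0 ≤ m.mu13 ∧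
  m.mu10 * x.ρ10 = 0 ∧ m.mu11 * x.ρ11 = 0 ∧ m.mu13 * x.ρ13 = 0 ∧
  m.lam0 * (x.R - x.J1 g P2 α) = 0 ∧ m.lam1 * (x.R - x.S4 g P2 α) = 0

/-! ### Quantities in the optimal power allocations

`q` is the power `ρ13`, `r` the power `ρ11`, `p` the power `ρ10`. -/

def a1 (g : Gains) : ℝ := (g.g10 ^ 2)⁻¹ - (g.g12 ^ 2)⁻¹
def a2 (g : Gains) (r : ℝ) : ℝ := (g.g10 ^ 2)⁻¹ + r
def a3 (g : Gains) (r : ℝ) : ℝ := (g.g12 ^ 2)⁻¹ + r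
def a4 (g : Gains) (P2 α q : ℝ) : ℝ := 1 + g.g20 / g.g10 * √(rho23 P2 α / q)
def a5 (g : Gains) (P2 α q : ℝ) : ℝ :=
  q + g.g20 ^ 2 / g.g10 ^ 2 * rho23 P2 α + 2 * (g.g20 / g.g10) * √(q * rho23 P2 α)

def b1 (g : Gains) (P1 P2 α q : ℝ) : ℝ :=
  a4 g P2 α q * (P1 + (g.g10 ^ 2)⁻¹ - (1 - α) * q) + α * a1 g
    + (1 - α) * (a4 g P2 α q * a1 g + a5 g P2 α q)

def b2 (g : Gains) (P1 P2 α q : ℝ) : ℝ :=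
  a1 g * P1 + (1 - α) * a1 g * (g.g20 ^ 2 / g.g10 ^ 2) * rho23 P2 α + (g.g10 ^ 2)⁻¹ * a1 g
    + 2 * (1 - α) * a1 g * (g.g20 / g.g10) * √(q * rho23 P2 α)

/-- `ρ11` as a function of `ρ13` in partial decode-forward with repetition. -/
def rho11Of (g : Gains) (P1 P2 α q : ℝ) : ℝ :=
  (2 * a4 g P2 α q)⁻¹ *
      (b1 g P1 P2 α q + √(b1 g P1 P2 α q ^ 2 - 4 * a4 g P2 α q * b2 g P1 P2 α q))
    - (g.g10 ^ 2)⁻¹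

/-- `ρ10` as a function of `ρ11` and `ρ13` in partial decode-forward with repetition. -/
def rho10Of (g : Gains) (P2 α r q : ℝ) : ℝ :=
  (g.g20 / g.g10 * √(rho23 P2 α / q) + a3 g r / a2 g r)⁻¹ *
      ((1 + g.g20 / g.g10 * √(rho23 P2 α / q)) * a3 g r - a3 g r / a2 g r * a5 g P2 α q)
    - (g.g10 ^ 2)⁻¹

def f1 (g : Gains) (P2 α p r q : ℝ) : ℝ :=
  α * cap (g.g10 ^ 2 * r) + (1 - α) * cap (g.g10 ^ 2 * (p + a5 g P2 α q))
    - α * cap (g.g12 ^ 2 * r)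

/-- The function of `ρ13` whose root is sought in partial decode-forward with repetition. -/
def f2 (g : Gains) (P1 P2 α q : ℝ) : ℝ :=
  let r := rho11Of g P1 P2 α q
  let p := rho10Of g P2 α r q
  (1 - α)⁻¹ * (P1 - α * r) - q
    - (g.g10 ^ 2)⁻¹ * ((2 : ℝ) ^ (f1 g P2 α p r q / (1 - α)) - 1)

def f3 (g : Gains) (P2 α q : ℝ) : ℝ := (1 - α) / α * cap (g.g10 ^ 2 * a5 g P2 α q)

/-- The function of `ρ13` whose root is sought in decode-forward. -/
def f4 (g : Gains) (P1 P2 α q : ℝ) : ℝ :=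
  (P1 - (1 - α) * q) / α
    - (g.g10 ^ 2)⁻¹ *
      ((1 - g.g12 ^ 2 / g.g10 ^ 2) / ((2 : ℝ) ^ f3 g P2 α q - g.g12 ^ 2 / g.g10 ^ 2) - 1)

/-! ### The four cases for `g12 ≥ g10` -/

/-- `S₄` has a positive multiplier, `ρ10 ≥ 0` does not. -/
def Case2a (m : Multipliers) : Prop := 0 < m.lam1 ∧ m.mu10 = 0

/-- `S₄` and `ρ10 ≥ 0` have positive multipliers. -/
def Case2b (m : Multipliers) : Prop := 0 < m.lam1 ∧ 0 < m.mu10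

/-- Neither `S₄` nor `ρ10 ≥ 0` has a positive multiplier. -/
def Case3a (m : Multipliers) : Prop := m.lam1 = 0 ∧ m.mu10 = 0

/-- `ρ10 ≥ 0` has a positive multiplier, `S₄` does not. -/
def Case3b (m : Multipliers) : Prop := m.lam1 = 0 ∧ 0 < m.mu10

/-- The assertion for a KKT solution in the first case. -/
def Case2aConclusion (g : Gains) (P1 P2 α : ℝ) (x : Point) (m : Multipliers) : Prop :=
  0 < m.lam0 ∧ x.R = x.J1 g P2 α ∧ x.R = x.S4 g P2 α ∧
  0 < x.ρ13 ∧ f2 g P1 P2 α x.ρ13 = 0 ∧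
  x.ρ11 = rho11Of g P1 P2 α x.ρ13 ∧ x.ρ10 = rho10Of g P2 α x.ρ11 x.ρ13 ∧
  (0 < x.ρ10 → UsesScheme g (relayDesign P2 α x) x.R IsPDFRepetition) ∧
  (x.ρ10 = 0 → UsesScheme g (relayDesign P2 α x) x.R IsDF)

/-- The assertion for a KKT solution in the second case. -/
def Case2bConclusion (g : Gains) (P1 P2 α : ℝ) (x : Point) (m : Multipliers) : Prop :=
  x.R = x.S4 g P2 α ∧ x.ρ10 = 0 ∧ 0 < x.ρ13 ∧ x.ρ11 = α⁻¹ * (P1 - (1 - α) * x.ρ13) ∧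
  (0 < m.lam0 → x.R = x.J1 g P2 α ∧ f4 g P1 P2 α x.ρ13 = 0) ∧
  (m.lam0 = 0 →
    a4 g P2 α x.ρ13 * a2 g x.ρ11 = (g.g10 ^ 2)⁻¹ + a5 g P2 α x.ρ13) ∧
  UsesScheme g (relayDesign P2 α x) x.R IsDF

/-- The assertion for a KKT solution in the third case. -/
def Case3aConclusion (g : Gains) (P1 P2 α : ℝ) (x : Point) (m : Multipliers) : Prop :=
  0 < m.lam0 ∧ 0 < m.mu13 ∧ x.R = x.J1 g P2 α ∧
  x.ρ13 = 0 ∧ x.ρ11 = P1 + (1 - α) * a1 g ∧ x.ρ10 = P1 - α * a1 g ∧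
  (0 < x.ρ10 → UsesScheme g (relayDesign P2 α x) x.R IsPDFNoRepetition) ∧
  (x.ρ10 = 0 → UsesScheme g (relayDesign P2 α x) x.R IsTwoHop)

/-- The assertion for a KKT solution in the fourth case. -/
def Case3bConclusion (g : Gains) (P1 P2 α : ℝ) (x : Point) (m : Multipliers) : Prop :=
  0 < m.lam0 ∧ 0 < m.mu13 ∧ x.R = x.J1 g P2 α ∧
  x.ρ13 = 0 ∧ x.ρ10 = 0 ∧ x.ρ11 = P1 / α ∧
  UsesScheme g (relayDesign P2 α x) x.R IsTwoHop

end

end RelayMAC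

open RelayMAC

open RelayMAC
namespace RelayMAC

/-! ### The capacity function -/

/-! For fixed `α` the relay problem maximizes the smaller of two concave functions, `relayJ` and
`relayS`, over a compact simplex of powers. Each is strictly concave there: `relayJ` sees `ρ10` and
`ρ11`, `relayS` is strict in `ρ11` and, through the square root in `a5`, in `ρ13`, and the power
equality fixes the remaining coordinate (`strictConcaveOn_relayJ`, `strictConcaveOn_relayS`). Hence
there is exactly one solution.

A KKT point is optimal because the Lagrangian is concave, so a zero derivative is a global maximum.
Conversely, separating the pairs dominated by `(J₁, S₄)` from an open quadrant yields weights for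
which the solution maximizes a weighted sum of the two bounds (`exists_convexCombination_le`). The
derivative of that sum is linear, and its slacks at the three vertices of the simplex are the
multipliers of the sign constraints. The one obstacle is that `√(ρ13 ρ23)` is not differentiable at
`ρ13 = 0`. Its infinite slope there is also the remedy: if `S₄` has positive weight, shifting a
little power to `ρ13` pays off, so `ρ13 > 0` (`thd_pos_of_isMaxOn`); if it has weight zero, `S₄`
drops out of the Lagrangian.

The four cases then follow by solving the equations of `IsKKT.stationary`, with complementary
slackness deciding which bounds are tight and which message parts are nonempty.

The three-phase scheme reduces to the relay problem because, by concavity of `cap`, averaging user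
1's powers over phases 2 and 3 and letting user 2 cooperate throughout that time loses nothing
(`exists_feasible_point`). When `g12 < g10`, replacing `g12` by `g10` and applying concavity bounds
`J₁` by the direct rate, and strictness identifies the equality case (`J1_le_cap`). -/

theorem cap_zero : cap 0 = 0 := by simp [cap]

theorem strictMonoOn_cap : StrictMonoOn cap (Set.Ici 0) := by
  intro x hx y _ hxy
  have hx : 0 ≤ x := hx
  exact Real.logb_lt_logb one_lt_two (by linarith) (by linarith)

theorem cap_lt_cap {x y : ℝ} (hx : 0 ≤ x) (hxy : x < y) : cap x < cap y :=
  strictMonoOn_cap hx (hx.trans hxy.le) hxy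

theorem cap_le_cap {x y : ℝ} (hx : 0 ≤ x) (hxy : x ≤ y) : cap x ≤ cap y :=
  strictMonoOn_cap.monotoneOn hx (hx.trans hxy) hxy

theorem cap_nonneg {x : ℝ} (hx : 0 ≤ x) : 0 ≤ cap x := by
  simpa [cap_zero] using cap_le_cap le_rfl hx

theorem cap_pos {x : ℝ} (hx : 0 < x) : 0 < cap x := by
  simpa [cap_zero] using cap_lt_cap le_rfl hx

theorem cap_le_cap_iff {x y : ℝ} (hx : 0 ≤ x) (hy : 0 ≤ y) : cap x ≤ cap y ↔ x ≤ y :=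
  strictMonoOn_cap.le_iff_le hx hy

theorem two_rpow_cap {x : ℝ} (hx : 0 ≤ x) : (2 : ℝ) ^ cap x = 1 + x :=
  Real.rpow_logb two_pos (by norm_num) (by linarith)

theorem hasDerivAt_cap {x : ℝ} (hx : 0 ≤ x) : HasDerivAt cap (1 / ((1 + x) * Real.log 2)) x := by
  have h : HasDerivAt (fun y : ℝ => Real.log (1 + y) / Real.log 2)
      (1 / (1 + x) / Real.log 2) x :=
    (((hasDerivAt_id x).const_add 1).log (by simp; linarith)).div_const _
  rw [div_div] at h
  exact h

theorem continuousOn_cap : ContinuousOn cap (Set.Ici 0) :=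
  fun _ hx => (hasDerivAt_cap hx).continuousAt.continuousWithinAt

theorem strictConcaveOn_cap : StrictConcaveOn ℝ (Set.Ici 0) cap := by
  refine ⟨convex_Ici 0, fun x hx y hy hxy a b ha hb hab => ?_⟩
  have hx : 0 ≤ x := hx
  have hy : 0 ≤ y := hy
  have h := strictConcaveOn_log_Ioi.2 (x := 1 + x) (y := 1 + y) (Set.mem_Ioi.2 (by linarith))
    (Set.mem_Ioi.2 (by linarith)) (by simpa using hxy) ha hb hab
  have e : a • (1 + x) + b • (1 + y) = 1 + (a • x + b • y) := by
    simp only [smul_eq_mul]; linear_combination hab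
  rw [e] at h
  have hl := div_lt_div_of_pos_right h (Real.log_pos one_lt_two)
  simp only [cap, Real.logb, smul_eq_mul] at hl ⊢
  refine lt_of_eq_of_lt ?_ hl
  ring

/-- Concavity of `cap` for weights of total `t`. -/
theorem mul_cap_add_mul_cap_le {a b t x y : ℝ} (ha : 0 ≤ a) (hb : 0 ≤ b) (ht : 0 < t)
    (hab : a + b = t) (hx : 0 ≤ x) (hy : 0 ≤ y) :
    a * cap x + b * cap y ≤ t * cap ((a * x + b * y) / t) := by
  have h := strictConcaveOn_cap.concaveOn.2 (Set.mem_Ici.2 hx) (Set.mem_Ici.2 hy)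
    (div_nonneg ha ht.le) (div_nonneg hb ht.le) (by rw [← add_div, hab, div_self ht.ne'])
  simp only [smul_eq_mul] at h
  have h2 := mul_le_mul_of_nonneg_left h ht.le
  have e : a / t * x + b / t * y = (a * x + b * y) / t := by ring
  rw [e] at h2
  refine le_trans (le_of_eq ?_) h2
  field_simp

/-- The remaining time `t - a` is filled with zero power, where `cap` vanishes. -/
theorem mul_cap_le {a t x : ℝ} (ha : 0 ≤ a) (hat : a ≤ t) (ht : 0 < t) (hx : 0 ≤ x) :
    a * cap x ≤ t * cap (a * x / t) := by
  simpa [cap_zero] using mul_cap_add_mul_cap_le ha (sub_nonneg.2 hat) ht (by ring) hx le_rfl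

theorem mul_cap_lt {a x : ℝ} (ha : 0 < a) (ha1 : a < 1) (hx : 0 < x) :
    a * cap x < cap (a * x) := by
  have h := strictConcaveOn_cap.2 (x := x) (y := 0) hx.le (le_refl (0 : ℝ)) hx.ne' ha
    (sub_pos.2 ha1) (by ring)
  simpa [cap_zero] using h

/-- Derivative of `C(γ² (t + c))` in `t`. -/
theorem hasDerivAt_cap_sq_mul {γ t c : ℝ} (hγ : 0 < γ) (h : 0 ≤ t + c) :
    HasDerivAt (fun t => cap (γ ^ 2 * (t + c))) (1 / (((γ ^ 2)⁻¹ + (t + c)) * Real.log 2)) t := by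
  have h1 : HasDerivAt (fun t => γ ^ 2 * (t + c)) (γ ^ 2) t := by
    simpa using ((hasDerivAt_id t).add_const c).const_mul (γ ^ 2)
  have h2 := (hasDerivAt_cap (x := γ ^ 2 * (t + c)) (by positivity)).comp t h1
  refine h2.congr_deriv ?_
  have : 0 < Real.log 2 := Real.log_pos one_lt_two
  field_simp

theorem hasDerivAt_cap_sq_mul' {γ t : ℝ} (hγ : 0 < γ) (h : 0 ≤ t) :
    HasDerivAt (fun t => cap (γ ^ 2 * t)) (1 / (((γ ^ 2)⁻¹ + t) * Real.log 2)) t := by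
  simpa using hasDerivAt_cap_sq_mul (c := 0) hγ (by simpa using h)

/-! ### The two rate bounds as functions of `(ρ10, ρ11, ρ13)` -/

noncomputable section

/-- `J₁` as a function of `v = (ρ10, ρ11, ρ13)`. -/
def relayJ (g : Gains) (α : ℝ) (v : ℝ × ℝ × ℝ) : ℝ :=
  α * cap (g.g12 ^ 2 * v.2.1) + (1 - α) * cap (g.g10 ^ 2 * v.1)

/-- `S₄` as a function of `v = (ρ10, ρ11, ρ13)`. -/
def relayS (g : Gains) (P2 α : ℝ) (v : ℝ × ℝ × ℝ) : ℝ :=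
  α * cap (g.g10 ^ 2 * v.2.1) + (1 - α) * cap (g.g10 ^ 2 * (v.1 + a5 g P2 α v.2.2))

/-- The power equality is left out because the Lagrangian is maximized over all nonnegative powers.
-/
def orthant : Set (ℝ × ℝ × ℝ) := {v | 0 ≤ v.1 ∧ 0 ≤ v.2.1 ∧ 0 ≤ v.2.2}

/-- The valid power allocations `(ρ10, ρ11, ρ13)`. -/
def powerSimplex (P1 α : ℝ) : Set (ℝ × ℝ × ℝ) :=
  {v | v ∈ orthant ∧ α * v.2.1 + (1 - α) * (v.1 + v.2.2) = P1}

/-- The powers of a point, as a vector. -/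
def Point.powers (x : Point) : ℝ × ℝ × ℝ := (x.ρ10, x.ρ11, x.ρ13)

end

theorem Point.J1_eq (g : Gains) (P2 α : ℝ) (x : Point) : x.J1 g P2 α = relayJ g α x.powers := by
  simp [Point.J1, Design.J1, Design.I1, Design.I3, Design.α3, relayDesign, relayJ, Point.powers]

/-- The signals carrying `U₃` add coherently: `a5` is `(√ρ13 + (g20/g10) √ρ23)²`, their joint
received power measured in units of `g10²`. -/
theorem zeta_eq {g : Gains} (hg : g.Pos) (P2 α : ℝ) (x : Point) :
    (relayDesign P2 α x).ζ g = g.g10 ^ 2 * (x.ρ10 + a5 g P2 α x.ρ13) := by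
  have := hg.2.2.1
  simp only [Design.ζ, relayDesign, a5]
  field_simp
  ring

theorem Point.S4_eq {g : Gains} (hg : g.Pos) (P2 α : ℝ) (x : Point) :
    x.S4 g P2 α = relayS g P2 α x.powers := by
  have h := zeta_eq hg P2 α x
  simp only [Point.S4, Design.S4, Design.I8, Design.α3, relayS, Point.powers, h]
  simp [relayDesign]

theorem Point.validPower_iff (P1 α : ℝ) (x : Point) :
    x.ValidPower P1 α ↔ x.powers ∈ powerSimplex P1 α := by
  simp only [Point.ValidPower, powerSimplex, orthant, Point.powers, Set.mem_ofPred_eq]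
  tauto

theorem Point.feasible_iff {g : Gains} (hg : g.Pos) (P1 P2 α : ℝ) (x : Point) :
    x.Feasible g P1 P2 α ↔ x.powers ∈ powerSimplex P1 α ∧ x.R ≤ relayJ g α x.powers ∧
      x.R ≤ relayS g P2 α x.powers := by
  rw [Point.Feasible, Point.validPower_iff, Point.J1_eq, Point.S4_eq hg]

theorem rho23_pos {P2 α : ℝ} (hP2 : 0 < P2) (hα : α < 1) : 0 < rho23 P2 α :=
  div_pos hP2 (sub_pos.2 hα)

theorem lt_a5 {g : Gains} (hg : g.Pos) {P2 α : ℝ} (hP2 : 0 < P2) (hα : α < 1) (q : ℝ) :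
    q < a5 g P2 α q := by
  have h1 := rho23_pos hP2 hα
  obtain ⟨-, -, h2, h3⟩ := hg
  rw [a5, add_assoc]
  exact lt_add_of_pos_right _ (by positivity)

theorem a5_pos {g : Gains} (hg : g.Pos) {P2 α q : ℝ} (hP2 : 0 < P2) (hα : α < 1) (hq : 0 ≤ q) :
    0 < a5 g P2 α q := hq.trans_lt (lt_a5 hg hP2 hα q)

theorem continuous_a5 (g : Gains) (P2 α : ℝ) : Continuous (a5 g P2 α) := by
  unfold a5
  fun_prop

/-- All strictness comes from the cross term, a positive multiple of `√q` because user 2 has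
positive power. -/
theorem strictConcaveOn_a5 {g : Gains} (hg : g.Pos) {P2 α : ℝ} (hP2 : 0 < P2) (hα : α < 1) :
    StrictConcaveOn ℝ (Set.Ici 0) (a5 g P2 α) := by
  have hs := rho23_pos hP2 hα
  obtain ⟨-, -, h10, h20⟩ := hg
  refine ⟨convex_Ici 0, fun x hx y hy hxy a b ha hb hab => ?_⟩
  have h := Real.strictConcaveOn_sqrt.2 hx hy hxy ha hb hab
  have h2 := mul_lt_mul_of_pos_left h
    (show 0 < 2 * (g.g20 / g.g10) * √(rho23 P2 α) by positivity)
  simp only [smul_eq_mul, a5, Real.sqrt_mul' _ hs.le] at h2 ⊢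
  linear_combination h2 + (g.g20 ^ 2 / g.g10 ^ 2 * rho23 P2 α) * hab

theorem convex_orthant : Convex ℝ orthant := by
  rintro x ⟨h1, h2, h3⟩ y ⟨k1, k2, k3⟩ a b ha hb -
  simp only [orthant, Set.mem_ofPred_eq, Prod.fst_add, Prod.snd_add, Prod.smul_fst, Prod.smul_snd,
    smul_eq_mul]
  refine ⟨?_, ?_, ?_⟩ <;> positivity

theorem convex_powerSimplex (P1 α : ℝ) : Convex ℝ (powerSimplex P1 α) := by
  rintro x ⟨hx, h1⟩ y ⟨hy, h2⟩ a b ha hb hab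
  refine ⟨convex_orthant hx hy ha hb hab, ?_⟩
  simp only [Prod.fst_add, Prod.snd_add, Prod.smul_fst, Prod.smul_snd, smul_eq_mul]
  linear_combination a * h1 + b * h2 + P1 * hab

/-- `cap` is concave and nondecreasing on nonnegative arguments. -/
theorem concaveOn_cap_comp {E : Type*} [AddCommGroup E] [Module ℝ E] {s : Set E} {f : E → ℝ}
    (hf : ConcaveOn ℝ s f) (h0 : ∀ x ∈ s, 0 ≤ f x) {c : ℝ} (hc : 0 ≤ c) :
    ConcaveOn ℝ s fun x => cap (c * f x) := by
  refine ⟨hf.1, fun x hx y hy a b ha hb hab => ?_⟩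
  have hx0 := h0 x hx
  have hy0 := h0 y hy
  refine (strictConcaveOn_cap.concaveOn.2 (x := c * f x) (y := c * f y)
    (Set.mem_Ici.2 (by positivity)) (Set.mem_Ici.2 (by positivity)) ha hb hab).trans
    (cap_le_cap (by simp only [smul_eq_mul]; positivity) ?_)
  have h := mul_le_mul_of_nonneg_left (hf.2 hx hy ha hb hab) hc
  simp only [smul_eq_mul] at h ⊢
  linarith

theorem concaveOn_fst_orthant : ConcaveOn ℝ orthant fun v => v.1 :=
  (LinearMap.fst ℝ ℝ (ℝ × ℝ)).concaveOn convex_orthant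

theorem concaveOn_snd_orthant : ConcaveOn ℝ orthant fun v => v.2.1 :=
  (LinearMap.fst ℝ ℝ ℝ ∘ₗ LinearMap.snd ℝ ℝ (ℝ × ℝ)).concaveOn convex_orthant

theorem concaveOn_snr {g : Gains} (hg : g.Pos) {P2 α : ℝ} (hP2 : 0 < P2) (hα : α < 1) :
    ConcaveOn ℝ orthant fun v => v.1 + a5 g P2 α v.2.2 := by
  refine concaveOn_fst_orthant.add ⟨convex_orthant, fun x hx y hy a b ha hb hab => ?_⟩
  exact (strictConcaveOn_a5 hg hP2 hα).concaveOn.2 hx.2.2 hy.2.2 ha hb hab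

theorem snr_pos {g : Gains} (hg : g.Pos) {P2 α : ℝ} (hP2 : 0 < P2) (hα : α < 1)
    {v : ℝ × ℝ × ℝ} (hv : v ∈ orthant) : 0 < v.1 + a5 g P2 α v.2.2 :=
  add_pos_of_nonneg_of_pos hv.1 (a5_pos hg hP2 hα hv.2.2)

theorem concaveOn_relayJ (g : Gains) {α : ℝ} (hα0 : 0 ≤ α) (hα : α ≤ 1) :
    ConcaveOn ℝ orthant (relayJ g α) :=
  ((concaveOn_cap_comp concaveOn_snd_orthant (fun _ h => h.2.1) (sq_nonneg _)).smul hα0).add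
    ((concaveOn_cap_comp concaveOn_fst_orthant (fun _ h => h.1) (sq_nonneg _)).smul
      (sub_nonneg.2 hα))

theorem concaveOn_relayS {g : Gains} (hg : g.Pos) {P2 α : ℝ} (hP2 : 0 < P2) (hα0 : 0 ≤ α)
    (hα : α < 1) : ConcaveOn ℝ orthant (relayS g P2 α) :=
  ((concaveOn_cap_comp concaveOn_snd_orthant (fun _ h => h.2.1) (sq_nonneg _)).smul hα0).add
    ((concaveOn_cap_comp (concaveOn_snr hg hP2 hα) (fun _ h => (snr_pos hg hP2 hα h).le)
      (sq_nonneg _)).smul (sub_nonneg.2 hα.le))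

theorem continuousOn_relayJ (g : Gains) (α : ℝ) : ContinuousOn (relayJ g α) orthant := by
  refine (continuousOn_const.mul (continuousOn_cap.comp (by fun_prop) fun v hv => ?_)).add
    (continuousOn_const.mul (continuousOn_cap.comp (by fun_prop) fun v hv => ?_))
  · exact mul_nonneg (sq_nonneg _) hv.2.1
  · exact mul_nonneg (sq_nonneg _) hv.1

theorem continuousOn_relayS {g : Gains} (hg : g.Pos) {P2 α : ℝ} (hP2 : 0 < P2) (hα : α < 1) :
    ContinuousOn (relayS g P2 α) orthant := by
  have := continuous_a5 g P2 α
  refine (continuousOn_const.mul (continuousOn_cap.comp (by fun_prop) fun v hv => ?_)).add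
    (continuousOn_const.mul (continuousOn_cap.comp (by fun_prop) fun v hv => ?_))
  · exact mul_nonneg (sq_nonneg _) hv.2.1
  · exact mul_nonneg (sq_nonneg _) (snr_pos hg hP2 hα hv).le

/-- `ρ13` does not enter, so strictness fails on the whole orthant; under the power equality, two
allocations with equal `ρ10` and `ρ11` coincide. -/
theorem strictConcaveOn_relayJ {g : Gains} (hg : g.Pos) (P1 : ℝ) {α : ℝ} (hα0 : 0 < α)
    (hα : α < 1) : StrictConcaveOn ℝ (powerSimplex P1 α) (relayJ g α) := by
  have hβ := sub_pos.2 hα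
  obtain ⟨h12, -, h10, -⟩ := hg
  refine ⟨convex_powerSimplex P1 α, ?_⟩
  rintro ⟨p, r, q⟩ ⟨⟨hp, hr, hq⟩, hx⟩ ⟨p', r', q'⟩ ⟨⟨hp', hr', hq'⟩, hy⟩ hne a b ha hb hab
  simp only at hp hr hq hp' hr' hq' hx hy
  have key : ∀ {γ : ℝ}, 0 < γ → ∀ {s t : ℝ}, 0 ≤ s → 0 ≤ t →
      a * cap (γ ^ 2 * s) + b * cap (γ ^ 2 * t) ≤ cap (γ ^ 2 * (a * s + b * t)) ∧
      (s ≠ t → a * cap (γ ^ 2 * s) + b * cap (γ ^ 2 * t) < cap (γ ^ 2 * (a * s + b * t))) := by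
    intro γ hγ s t hs ht
    have e : γ ^ 2 * (a * s + b * t) = a • (γ ^ 2 * s) + b • (γ ^ 2 * t) := by
      simp only [smul_eq_mul]; ring
    rw [e]
    have hs' : γ ^ 2 * s ∈ Set.Ici (0 : ℝ) := Set.mem_Ici.2 (by positivity)
    have ht' : γ ^ 2 * t ∈ Set.Ici (0 : ℝ) := Set.mem_Ici.2 (by positivity)
    refine ⟨strictConcaveOn_cap.concaveOn.2 hs' ht' ha.le hb.le hab, fun hst =>
      strictConcaveOn_cap.2 hs' ht' (fun h => hst ?_) ha hb hab⟩
    exact mul_left_cancel₀ (by positivity) h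
  obtain ⟨k1, k1'⟩ := key h12 hr hr'
  obtain ⟨k2, k2'⟩ := key h10 hp hp'
  simp only [relayJ, Prod.fst_add, Prod.snd_add, Prod.smul_fst, Prod.smul_snd, smul_eq_mul]
  by_cases h1 : r = r'
  · have h2 : p ≠ p' := by
      rintro rfl
      subst h1
      refine hne ?_
      have : q = q' := by
        have : (1 - α) * q = (1 - α) * q' := by linear_combination hx - hy
        exact mul_left_cancel₀ hβ.ne' this
      rw [this]
    nlinarith [mul_lt_mul_of_pos_left (k2' h2) hβ, mul_le_mul_of_nonneg_left k1 hα0.le]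
  · nlinarith [mul_lt_mul_of_pos_left (k1' h1) hα0, mul_le_mul_of_nonneg_left k2 hβ.le]

/-- Different `ρ11` give strictness through the first term. With equal `ρ11`, the power equality
forces the `ρ13` to differ, and `a5` is strictly concave; the argument of the second `cap` may still
take equal values, so strictness of `cap` is not used there. -/
theorem strictConcaveOn_relayS {g : Gains} (hg : g.Pos) (P1 : ℝ) {P2 α : ℝ} (hP2 : 0 < P2)
    (hα0 : 0 < α) (hα : α < 1) : StrictConcaveOn ℝ (powerSimplex P1 α) (relayS g P2 α) := by
  have hβ := sub_pos.2 hα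
  have h10 := hg.2.2.1
  refine ⟨convex_powerSimplex P1 α, ?_⟩
  rintro ⟨p, r, q⟩ ⟨⟨hp, hr, hq⟩, hx⟩ ⟨p', r', q'⟩ ⟨⟨hp', hr', hq'⟩, hy⟩ hne a b ha hb hab
  simp only at hp hr hq hp' hr' hq' hx hy
  have key : ∀ {s t : ℝ}, 0 ≤ s → 0 ≤ t →
      a * cap (g.g10 ^ 2 * s) + b * cap (g.g10 ^ 2 * t) ≤ cap (g.g10 ^ 2 * (a * s + b * t)) ∧
      (s ≠ t → a * cap (g.g10 ^ 2 * s) + b * cap (g.g10 ^ 2 * t) <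
        cap (g.g10 ^ 2 * (a * s + b * t))) := by
    intro s t hs ht
    have e : g.g10 ^ 2 * (a * s + b * t) = a • (g.g10 ^ 2 * s) + b • (g.g10 ^ 2 * t) := by
      simp only [smul_eq_mul]; ring
    rw [e]
    have hs' : g.g10 ^ 2 * s ∈ Set.Ici (0 : ℝ) := Set.mem_Ici.2 (by positivity)
    have ht' : g.g10 ^ 2 * t ∈ Set.Ici (0 : ℝ) := Set.mem_Ici.2 (by positivity)
    refine ⟨strictConcaveOn_cap.concaveOn.2 hs' ht' ha.le hb.le hab, fun hst =>
      strictConcaveOn_cap.2 hs' ht' (fun h => hst ?_) ha hb hab⟩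
    exact mul_left_cancel₀ (by positivity) h
  have hz : 0 ≤ p + a5 g P2 α q := add_nonneg hp (a5_pos hg hP2 hα hq).le
  have hz' : 0 ≤ p' + a5 g P2 α q' := add_nonneg hp' (a5_pos hg hP2 hα hq').le
  obtain ⟨k1, k1'⟩ := key hr hr'
  obtain ⟨k2, -⟩ := key hz hz'
  have ha5 : q ≠ q' → _ := fun h => (strictConcaveOn_a5 hg hP2 hα).2 hq hq' h ha hb hab
  have ha5' := (strictConcaveOn_a5 hg hP2 hα).concaveOn.2 hq hq' ha.le hb.le hab
  simp only [smul_eq_mul] at ha5 ha5'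
  have h0 : 0 ≤ g.g10 ^ 2 * (a * (p + a5 g P2 α q) + b * (p' + a5 g P2 α q')) := by positivity
  simp only [relayS, Prod.fst_add, Prod.snd_add, Prod.smul_fst, Prod.smul_snd, smul_eq_mul]
  by_cases h1 : r = r'
  · have h2 : q ≠ q' := by
      rintro rfl
      subst h1
      refine hne ?_
      have : p = p' := by
        have : (1 - α) * p = (1 - α) * p' := by linear_combination hx - hy
        exact mul_left_cancel₀ hβ.ne' this
      rw [this]
    have k3 := cap_lt_cap h0 (y := g.g10 ^ 2 * (a * p + b * p' + a5 g P2 α (a * q + b * q')))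
      (mul_lt_mul_of_pos_left (by linarith [ha5 h2]) (by positivity))
    nlinarith [mul_lt_mul_of_pos_left (k2.trans_lt k3) hβ, mul_le_mul_of_nonneg_left k1 hα0.le]
  · have k3 := cap_le_cap h0 (y := g.g10 ^ 2 * (a * p + b * p' + a5 g P2 α (a * q + b * q')))
      (mul_le_mul_of_nonneg_left (by linarith [ha5']) (by positivity))
    nlinarith [mul_lt_mul_of_pos_left (k1' h1) hα0,
      mul_le_mul_of_nonneg_left (k2.trans k3) hβ.le]

/-! ### Existence and uniqueness of the solution -/

theorem isCompact_powerSimplex (P1 : ℝ) {α : ℝ} (hα0 : 0 < α) (hα : α < 1) :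
    IsCompact (powerSimplex P1 α) := by
  have hβ := sub_pos.2 hα
  refine IsCompact.of_isClosed_subset
    (isCompact_Icc (a := ((0, 0, 0) : ℝ × ℝ × ℝ)) (b := (P1 / (1 - α), P1 / α, P1 / (1 - α)))) ?_ ?_
  · have h1 : IsClosed {v : ℝ × ℝ × ℝ | 0 ≤ v.1} := isClosed_le (by fun_prop) (by fun_prop)
    have h2 : IsClosed {v : ℝ × ℝ × ℝ | 0 ≤ v.2.1} := isClosed_le (by fun_prop) (by fun_prop)
    have h3 : IsClosed {v : ℝ × ℝ × ℝ | 0 ≤ v.2.2} := isClosed_le (by fun_prop) (by fun_prop)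
    have h4 : IsClosed {v : ℝ × ℝ × ℝ | α * v.2.1 + (1 - α) * (v.1 + v.2.2) = P1} :=
      isClosed_eq (by fun_prop) (by fun_prop)
    exact (h1.inter (h2.inter h3)).inter h4
  · rintro ⟨p, r, q⟩ ⟨⟨hp, hr, hq⟩, hx⟩
    simp only at hp hr hq hx
    have h1 := mul_nonneg hβ.le hp
    have h2 := mul_nonneg hα0.le hr
    have h3 := mul_nonneg hβ.le hq
    refine ⟨⟨hp, hr, hq⟩, ?_, ?_, ?_⟩ <;> simp only <;> rw [le_div_iff₀ (by assumption)] <;>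
      linarith

/-- The vertices, at which all power goes to a single component, serve to compare derivatives and to
exhibit positive rates. -/
theorem vertex_fst_mem {P1 α : ℝ} (hP1 : 0 ≤ P1) (hα : α < 1) :
    ((P1 / (1 - α), 0, 0) : ℝ × ℝ × ℝ) ∈ powerSimplex P1 α := by
  have hβ := sub_pos.2 hα
  refine ⟨⟨by positivity, le_rfl, le_rfl⟩, ?_⟩
  field_simp
  ring

theorem vertex_snd_mem {P1 α : ℝ} (hP1 : 0 ≤ P1) (hα : 0 < α) :
    ((0, P1 / α, 0) : ℝ × ℝ × ℝ) ∈ powerSimplex P1 α := by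
  refine ⟨⟨le_rfl, by positivity, le_rfl⟩, ?_⟩
  field_simp
  ring

theorem vertex_thd_mem {P1 α : ℝ} (hP1 : 0 ≤ P1) (hα : α < 1) :
    ((0, 0, P1 / (1 - α)) : ℝ × ℝ × ℝ) ∈ powerSimplex P1 α := by
  have hβ := sub_pos.2 hα
  refine ⟨⟨le_rfl, le_rfl, by positivity⟩, ?_⟩
  field_simp
  ring

/-- A point is optimal iff its powers maximize `min J₁ S₄` and its rate is that minimum. -/
theorem isOptimal_iff {g : Gains} (hg : g.Pos) {P1 P2 α : ℝ} (x : Point) :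
    IsOptimal g P1 P2 α x ↔ x.powers ∈ powerSimplex P1 α ∧
      IsMaxOn (relayJ g α ⊓ relayS g P2 α) (powerSimplex P1 α) x.powers ∧
      x.R = (relayJ g α ⊓ relayS g P2 α) x.powers := by
  simp only [IsOptimal, Point.feasible_iff hg, Pi.inf_apply]
  constructor
  · rintro ⟨⟨h1, h2, h3⟩, h4⟩
    have h5 : ∀ v ∈ powerSimplex P1 α, min (relayJ g α v) (relayS g P2 α v) ≤ x.R := fun v hv =>
      h4 ⟨min (relayJ g α v) (relayS g P2 α v), v.1, v.2.1, v.2.2⟩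
        ⟨hv, min_le_left _ _, min_le_right _ _⟩
    have h6 : x.R = min (relayJ g α x.powers) (relayS g P2 α x.powers) :=
      le_antisymm (le_min h2 h3) (h5 _ h1)
    exact ⟨h1, fun v hv => (h5 v hv).trans_eq h6, h6⟩
  · rintro ⟨h1, h2, h3⟩
    exact ⟨⟨h1, h3.trans_le inf_le_left, h3.trans_le inf_le_right⟩,
      fun y hy => (le_min hy.2.1 hy.2.2).trans ((h2 hy.1).trans_eq h3.symm)⟩

theorem existsUnique_isOptimal {g : Gains} (hg : g.Pos) {P1 P2 α : ℝ} (hP1 : 0 < P1)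
    (hP2 : 0 < P2) (hα0 : 0 < α) (hα : α < 1) : ∃! x : Point, IsOptimal g P1 P2 α x := by
  have hc : ContinuousOn (relayJ g α ⊓ relayS g P2 α) (powerSimplex P1 α) :=
    ((continuousOn_relayJ g α).inf (continuousOn_relayS hg hP2 hα)).mono fun _ h => h.1
  obtain ⟨v, hv, hmax⟩ := (isCompact_powerSimplex P1 hα0 hα).exists_isMaxOn
    ⟨_, vertex_fst_mem hP1.le hα⟩ hc
  refine ⟨⟨(relayJ g α ⊓ relayS g P2 α) v, v.1, v.2.1, v.2.2⟩,
    (isOptimal_iff hg _).2 ⟨hv, hmax, rfl⟩, fun y hy => ?_⟩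
  obtain ⟨h1, h2, h3⟩ := (isOptimal_iff hg _).1 hy
  have h4 : y.powers = v := ((strictConcaveOn_relayJ hg P1 hα0 hα).inf
    (strictConcaveOn_relayS hg P1 hP2 hα0 hα)).eq_of_isMaxOn h2 hmax h1 hv
  rw [← h4, ← h3]
  rfl


/-! ### Sufficiency of the KKT conditions -/

/-- On the line through `x` and `y` this is a concave function of one variable with derivative zero
at `x`, so its slope from `x` to `y` is at most zero. -/
theorem _root_.ConcaveOn.isMaxOn_of_hasFDerivAt_zero {E : Type*} [NormedAddCommGroup E]
    [NormedSpace ℝ E] {s : Set E} {f : E → ℝ} {x : E} (hf : ConcaveOn ℝ s f) (hx : x ∈ s)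
    (h : HasFDerivAt f (0 : E →L[ℝ] ℝ) x) : IsMaxOn f s x := by
  intro y hy
  have h1 : ConcaveOn ℝ (AffineMap.lineMap x y ⁻¹' s) (f ∘ AffineMap.lineMap (k := ℝ) x y) :=
    hf.comp_affineMap _
  have h0 : HasFDerivAt f (0 : E →L[ℝ] ℝ) (AffineMap.lineMap (k := ℝ) x y 0) := by simpa using h
  have h2 : HasDerivAt (f ∘ AffineMap.lineMap (k := ℝ) x y) 0 0 := by
    simpa using h0.comp_hasDerivAt (0 : ℝ) AffineMap.hasDerivAt_lineMap
  have h3 := h1.slope_le_of_hasDerivAt (x := 0) (y := 1) (by simpa using hx) (by simpa using hy)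
    zero_lt_one h2
  simpa [slope_def_field] using h3

theorem lagrangian_eq {g : Gains} (hg : g.Pos) (P1 P2 α : ℝ) (m : Multipliers)
    (v : ℝ × ℝ × ℝ × ℝ) :
    lagrangian g P1 P2 α m v = v.1 - m.lam0 * (v.1 - relayJ g α v.2)
      - m.lam1 * (v.1 - relayS g P2 α v.2)
      - m.lam2 * (α * v.2.2.1 + (1 - α) * (v.2.1 + v.2.2.2) - P1)
      + (m.mu10 * v.2.1 + m.mu11 * v.2.2.1 + m.mu13 * v.2.2.2) := by
  simp only [lagrangian, Point.J1_eq, Point.S4_eq hg, Point.powers]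

/-- Only the two rate multipliers need a sign; all other terms are affine. -/
theorem concaveOn_lagrangian {g : Gains} (hg : g.Pos) (P1 : ℝ) {P2 α : ℝ} (hP2 : 0 < P2)
    (hα0 : 0 ≤ α) (hα : α < 1) {m : Multipliers} (h0 : 0 ≤ m.lam0) (h1 : 0 ≤ m.lam1) :
    ConcaveOn ℝ (Prod.snd ⁻¹' orthant) (lagrangian g P1 P2 α m) := by
  refine ⟨convex_orthant.linear_preimage (LinearMap.snd ℝ ℝ (ℝ × ℝ × ℝ)),
    fun x hx y hy a b ha hb hab => ?_⟩
  have hJ := mul_le_mul_of_nonneg_left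
    ((concaveOn_relayJ g hα0 hα.le).2 hx hy ha hb hab) h0
  have hS := mul_le_mul_of_nonneg_left
    ((concaveOn_relayS hg hP2 hα0 hα).2 hx hy ha hb hab) h1
  simp only [lagrangian_eq hg, smul_eq_mul, Prod.fst_add, Prod.snd_add, Prod.smul_fst,
    Prod.smul_snd] at hJ hS ⊢
  linear_combination hJ + hS + m.lam2 * P1 * hab

theorem IsKKT.isOptimal {g : Gains} (hg : g.Pos) {P1 P2 α : ℝ} (hP2 : 0 < P2)
    (hα0 : 0 ≤ α) (hα : α < 1) {x : Point} {m : Multipliers} (h : IsKKT g P1 P2 α x m) :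
    IsOptimal g P1 P2 α x := by
  obtain ⟨hd, hf, h0, h1, h2, k0, k1, k3, c0, c1, c3, s0, s1⟩ := h
  refine ⟨hf, fun y hy => ?_⟩
  have hx := (Point.feasible_iff hg P1 P2 α x).1 hf
  have hy := (Point.feasible_iff hg P1 P2 α y).1 hy
  have hmax := (concaveOn_lagrangian hg P1 hP2 hα0 hα h0 h1).isMaxOn_of_hasFDerivAt_zero
    (x := (x.R, x.ρ10, x.ρ11, x.ρ13)) hx.1.1 hd
  have hle : lagrangian g P1 P2 α m (y.R, y.powers) ≤ lagrangian g P1 P2 α m (x.R, x.powers) :=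
    hmax hy.1.1
  simp only [lagrangian_eq hg] at hle
  rw [Point.J1_eq] at s0
  rw [Point.S4_eq hg] at s1
  -- Both points spend exactly `P1`, so the term of `lam2` vanishes at both.
  rw [hx.1.2, hy.1.2] at hle
  have e1 := mul_nonneg h0 (sub_nonneg.2 hy.2.1)
  have e2 := mul_nonneg h1 (sub_nonneg.2 hy.2.2)
  have e3 := mul_nonneg k0 hy.1.1.1
  have e4 := mul_nonneg k1 hy.1.1.2.1
  have e5 := mul_nonneg k3 hy.1.1.2.2
  have f3 : m.mu10 * x.powers.1 = 0 := c0
  have f4 : m.mu11 * x.powers.2.1 = 0 := c1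
  have f5 : m.mu13 * x.powers.2.2 = 0 := c3
  linarith

/-! ### Derivatives of the rate bounds -/

/-- This is the origin of `a4`. The restriction `0 < q` is essential, since the square root has
infinite slope at zero. -/
theorem hasDerivAt_a5 {g : Gains} {P2 α q : ℝ} (hP2 : 0 < P2) (hα : α < 1) (hq : 0 < q) :
    HasDerivAt (a5 g P2 α) (a4 g P2 α q) q := by
  have hs := rho23_pos hP2 hα
  have h1 : HasDerivAt (fun q => √(q * rho23 P2 α)) (rho23 P2 α / (2 * √(q * rho23 P2 α))) q := by
    have := ((hasDerivAt_id q).mul_const (rho23 P2 α)).sqrt (by simp [hq.ne', hs.ne'])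
    simpa using this
  have h2 := ((hasDerivAt_id q).add_const (g.g20 ^ 2 / g.g10 ^ 2 * rho23 P2 α)).add
    (h1.const_mul (2 * (g.g20 / g.g10)))
  refine h2.congr_deriv ?_
  have e : rho23 P2 α / (2 * √(q * rho23 P2 α)) = √(rho23 P2 α / q) / 2 := by
    have hq' := Real.sqrt_pos.2 hq
    have hs' := Real.sqrt_pos.2 hs
    rw [Real.sqrt_mul hq.le, Real.sqrt_div hs.le]
    field_simp
    rw [Real.sq_sqrt hs.le]
  rw [e, a4]
  ring

theorem hasFDerivAt_relayJ {g : Gains} (hg : g.Pos) (α : ℝ) {v : ℝ × ℝ × ℝ}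
    (hv : v ∈ orthant) :
    ∃ D : ℝ × ℝ × ℝ →L[ℝ] ℝ, HasFDerivAt (relayJ g α) D v ∧ ∀ w, D w =
      (1 - α) / (((g.g10 ^ 2)⁻¹ + v.1) * Real.log 2) * w.1
        + α / (a3 g v.2.1 * Real.log 2) * w.2.1 := by
  have h1 := (hasDerivAt_cap_sq_mul' hg.1 hv.2.1).comp_hasFDerivAt v
    ((ContinuousLinearMap.fst ℝ ℝ ℝ).comp (ContinuousLinearMap.snd ℝ ℝ (ℝ × ℝ))).hasFDerivAt
  have h2 := (hasDerivAt_cap_sq_mul' hg.2.2.1 hv.1).comp_hasFDerivAt v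
    (ContinuousLinearMap.fst ℝ ℝ (ℝ × ℝ)).hasFDerivAt
  refine ⟨_, (h1.const_mul α).add (h2.const_mul (1 - α)), fun w => ?_⟩
  simp [a3, div_eq_mul_inv]
  ring

theorem hasFDerivAt_relayS {g : Gains} (hg : g.Pos) {P2 α : ℝ} (hP2 : 0 < P2) (hα : α < 1)
    {v : ℝ × ℝ × ℝ} (hv : v ∈ orthant) (hq : 0 < v.2.2) :
    ∃ D : ℝ × ℝ × ℝ →L[ℝ] ℝ, HasFDerivAt (relayS g P2 α) D v ∧ ∀ w, D w =
      (1 - α) / (((g.g10 ^ 2)⁻¹ + (v.1 + a5 g P2 α v.2.2)) * Real.log 2) *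
          (w.1 + a4 g P2 α v.2.2 * w.2.2)
        + α / (a2 g v.2.1 * Real.log 2) * w.2.1 := by
  have h1 := (hasDerivAt_cap_sq_mul' hg.2.2.1 hv.2.1).comp_hasFDerivAt v
    ((ContinuousLinearMap.fst ℝ ℝ ℝ).comp (ContinuousLinearMap.snd ℝ ℝ (ℝ × ℝ))).hasFDerivAt
  have h3 := (hasDerivAt_a5 (g := g) hP2 hα hq).comp_hasFDerivAt v
    ((ContinuousLinearMap.snd ℝ ℝ ℝ).comp (ContinuousLinearMap.snd ℝ ℝ (ℝ × ℝ))).hasFDerivAt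
  have h2 := (hasDerivAt_cap_sq_mul' hg.2.2.1 (snr_pos hg hP2 hα hv).le).comp_hasFDerivAt v
    ((ContinuousLinearMap.fst ℝ ℝ (ℝ × ℝ)).hasFDerivAt.add h3)
  refine ⟨_, (h1.const_mul α).add (h2.const_mul (1 - α)), fun w => ?_⟩
  simp [a2, div_eq_mul_inv]
  ring

/-! ### Necessity of the KKT conditions -/

/-- Two concave functions whose minimum does not exceed `R` on `s` have a convex combination that
does not exceed `R` on `s`. -/
theorem exists_convexCombination_le {E : Type*} [AddCommGroup E] [Module ℝ E] {s : Set E}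
    {f₀ f₁ : E → ℝ} (h₀ : ConcaveOn ℝ s f₀) (h₁ : ConcaveOn ℝ s f₁) (hs : s.Nonempty) {R : ℝ}
    (hR : ∀ x ∈ s, min (f₀ x) (f₁ x) ≤ R) :
    ∃ l₀ l₁ : ℝ, 0 ≤ l₀ ∧ 0 ≤ l₁ ∧ l₀ + l₁ = 1 ∧ ∀ x ∈ s, l₀ * f₀ x + l₁ * f₁ x ≤ R := by
  -- Passing to all pairs dominated by a value `(f₀ x, f₁ x)` makes the set convex, by concavity. It
  -- misses the open quadrant above `(R, R)`, so a linear functional separates the two.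
  have hA : Convex ℝ {z : ℝ × ℝ | ∃ x ∈ s, z.1 ≤ f₀ x ∧ z.2 ≤ f₁ x} := by
    rintro z ⟨x, hx, hx0, hx1⟩ w ⟨y, hy, hy0, hy1⟩ a b ha hb hab
    refine ⟨a • x + b • y, h₀.1 hx hy ha hb hab, ?_, ?_⟩
    · exact (add_le_add (mul_le_mul_of_nonneg_left hx0 ha)
        (mul_le_mul_of_nonneg_left hy0 hb)).trans (h₀.2 hx hy ha hb hab)
    · exact (add_le_add (mul_le_mul_of_nonneg_left hx1 ha)
        (mul_le_mul_of_nonneg_left hy1 hb)).trans (h₁.2 hx hy ha hb hab)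
  obtain ⟨F, u, hB, hA'⟩ := geometric_hahn_banach_open
    ((convex_Ioi R).prod (convex_Ioi R)) (isOpen_Ioi.prod isOpen_Ioi) hA (by
      rw [Set.disjoint_left]
      rintro z ⟨hz0, hz1⟩ ⟨x, hx, hx0, hx1⟩
      exact absurd (hR x hx) (not_le.2 (lt_min (hz0.trans_le hx0) (hz1.trans_le hx1))))
  have hF : ∀ a b : ℝ, F (a, b) = a * F (1, 0) + b * F (0, 1) := by
    intro a b
    have e : ((a, b) : ℝ × ℝ) = a • (1, 0) + b • (0, 1) := by simp
    rw [e]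
    simp only [map_add, map_smul, smul_eq_mul]
  have hB' : ∀ a b : ℝ, R < a → R < b → a * F (1, 0) + b * F (0, 1) < u := fun a b ha hb => by
    rw [← hF]
    exact hB _ ⟨ha, hb⟩
  have hA2 : ∀ x ∈ s, u ≤ f₀ x * F (1, 0) + f₁ x * F (0, 1) := fun x hx => by
    rw [← hF]
    exact hA' _ ⟨x, hx, le_rfl, le_rfl⟩
  set c₀ := F (1, 0)
  set c₁ := F (0, 1)
  have hc := hB' (R + 1) (R + 1) (by linarith) (by linarith)
  -- The quadrant is unbounded in each coordinate, so a positive coefficient would push the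
  -- functional past `u`.
  have hc₀ : c₀ ≤ 0 := by
    by_contra! h
    set t := (u - ((R + 1) * c₀ + (R + 1) * c₁)) / c₀
    have ht : 0 < t := div_pos (by linarith) h
    have h1 := hB' (R + 1 + t) (R + 1) (by linarith) (by linarith)
    have h2 : t * c₀ = u - ((R + 1) * c₀ + (R + 1) * c₁) := div_mul_cancel₀ _ h.ne'
    linarith
  have hc₁ : c₁ ≤ 0 := by
    by_contra! h
    set t := (u - ((R + 1) * c₀ + (R + 1) * c₁)) / c₁
    have ht : 0 < t := div_pos (by linarith) h
    have h1 := hB' (R + 1) (R + 1 + t) (by linarith) (by linarith)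
    have h2 : t * c₁ = u - ((R + 1) * c₀ + (R + 1) * c₁) := div_mul_cancel₀ _ h.ne'
    linarith
  -- If both coefficients vanished, the quadrant would give `0 < u`, and any point of `s` would give
  -- `u ≤ 0`.
  have hsum : c₀ + c₁ < 0 := by
    rcases hc₀.lt_or_eq with h | h
    · linarith
    rcases hc₁.lt_or_eq with h' | h'
    · linarith
    obtain ⟨x, hx⟩ := hs
    have := hA2 x hx
    rw [h, h'] at this hc
    linarith
  -- The corner `(R, R)` is not in the open quadrant; it is approached along the diagonal.
  have hu : (c₀ + c₁) * R ≤ u := by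
    by_contra! h
    set t := ((c₀ + c₁) * R - u) / (-(c₀ + c₁))
    have ht : 0 < t := div_pos (by linarith) (by linarith)
    have h1 := hB' (R + t) (R + t) (by linarith) (by linarith)
    have h2 : t * (-(c₀ + c₁)) = (c₀ + c₁) * R - u := div_mul_cancel₀ _ (by linarith)
    linarith
  refine ⟨c₀ / (c₀ + c₁), c₁ / (c₀ + c₁), div_nonneg_of_nonpos hc₀ hsum.le,
    div_nonneg_of_nonpos hc₁ hsum.le, by rw [← add_div, div_self hsum.ne], fun x hx => ?_⟩
  have e : c₀ / (c₀ + c₁) * f₀ x + c₁ / (c₀ + c₁) * f₁ x =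
      (f₀ x * c₀ + f₁ x * c₁) / (c₀ + c₁) := by ring
  rw [e, div_le_iff_of_neg hsum]
  linarith [hA2 x hx]

/-- On a parabola `q = Q t²` the term `√(q ρ23)` is linear in `t`. -/
theorem a5_mul_sq (g : Gains) (P2 α Q : ℝ) {t : ℝ} (ht : 0 ≤ t) :
    a5 g P2 α (Q * t ^ 2) = g.g20 ^ 2 / g.g10 ^ 2 * rho23 P2 α +
      2 * (g.g20 / g.g10) * √(Q * rho23 P2 α) * t + Q * t ^ 2 := by
  have e : Q * t ^ 2 * rho23 P2 α = (Q * rho23 P2 α) * t ^ 2 := by ring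
  rw [a5, e, Real.sqrt_mul' _ (sq_nonneg t), Real.sqrt_sq ht]
  ring

/-- A maximizer of a combination of `J₁` and `S₄` in which `S₄` has positive weight has
`ρ13 > 0`. -/
theorem thd_pos_of_isMaxOn {g : Gains} (hg : g.Pos) {P1 P2 α : ℝ} (hP1 : 0 < P1) (hP2 : 0 < P2)
    (hα : α < 1) {l₀ l₁ : ℝ} (h1 : 0 < l₁) {v : ℝ × ℝ × ℝ}
    (hv : v ∈ powerSimplex P1 α)
    (hmax : ∀ w ∈ powerSimplex P1 α, l₀ * relayJ g α w + l₁ * relayS g P2 α w ≤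
      l₀ * relayJ g α v + l₁ * relayS g P2 α v) : 0 < v.2.2 := by
  obtain ⟨p, r, q⟩ := v
  rcases hv.1.2.2.lt_or_eq with h | h
  · exact h
  exfalso
  simp only at h
  subst h
  have hβ := sub_pos.2 hα
  have hs := rho23_pos hP2 hα
  have hp : 0 ≤ p := hv.1.1
  have hr : 0 ≤ r := hv.1.2.1
  have h12 := hg.1
  have h10 := hg.2.2.1
  have h20 := hg.2.2.2
  -- The value of `ρ13` at the vertex where it takes all power.
  set Q := P1 / (1 - α)
  have hQ : 0 < Q := by positivity
  set K := g.g20 ^ 2 / g.g10 ^ 2 * rho23 P2 α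
  set c := 2 * (g.g20 / g.g10) * √(Q * rho23 P2 α)
  have hK : 0 < K := by positivity
  have hc : 0 < c := by positivity
  have hr' : HasDerivAt (fun t : ℝ => (1 - t ^ 2) * r) 0 0 := by
    simpa using ((hasDerivAt_pow 2 (0 : ℝ)).const_sub 1).mul_const r
  have hp' : HasDerivAt (fun t : ℝ => (1 - t ^ 2) * p) 0 0 := by
    simpa using ((hasDerivAt_pow 2 (0 : ℝ)).const_sub 1).mul_const p
  have hz : HasDerivAt (fun t : ℝ => (1 - t ^ 2) * p + (K + c * t + Q * t ^ 2)) c 0 := by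
    have := hp'.add ((((hasDerivAt_id (0 : ℝ)).const_mul c).const_add K).add
      ((hasDerivAt_pow 2 (0 : ℝ)).const_mul Q))
    exact this.congr_deriv (by simp)
  have d1 := HasDerivAt.comp (0 : ℝ) (h₂ := fun t => cap (g.g12 ^ 2 * t))
    (hasDerivAt_cap_sq_mul' h12 (t := (1 - (0 : ℝ) ^ 2) * r) (by simpa using hr)) hr'
  have d2 := HasDerivAt.comp (0 : ℝ) (h₂ := fun t => cap (g.g10 ^ 2 * t))
    (hasDerivAt_cap_sq_mul' h10 (t := (1 - (0 : ℝ) ^ 2) * p) (by simpa using hp)) hp'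
  have d3 := HasDerivAt.comp (0 : ℝ) (h₂ := fun t => cap (g.g10 ^ 2 * t))
    (hasDerivAt_cap_sq_mul' h10 (t := (1 - (0 : ℝ) ^ 2) * r) (by simpa using hr)) hr'
  have hz0 : 0 ≤ (1 - (0 : ℝ) ^ 2) * p + (K + c * 0 + Q * 0 ^ 2) := by simp; positivity
  have d4 := HasDerivAt.comp (0 : ℝ) (h₂ := fun t => cap (g.g10 ^ 2 * t))
    -- Moving a fraction `t²` of the way to that vertex costs only order `t²` in the other powers,
    -- while the cross term gains `c * t`.
    (hasDerivAt_cap_sq_mul' h10 hz0) hz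
  have d : HasDerivAt (fun t : ℝ => l₀ * (α * cap (g.g12 ^ 2 * ((1 - t ^ 2) * r)) +
      (1 - α) * cap (g.g10 ^ 2 * ((1 - t ^ 2) * p))) +
      l₁ * (α * cap (g.g10 ^ 2 * ((1 - t ^ 2) * r)) +
      (1 - α) * cap (g.g10 ^ 2 * ((1 - t ^ 2) * p + (K + c * t + Q * t ^ 2))))) _ 0 := (((d1.const_mul α).add (d2.const_mul (1 - α))).const_mul l₀).add
    (((d3.const_mul α).add (d4.const_mul (1 - α))).const_mul l₁)
  have hmaxOn : IsMaxOn (fun t : ℝ => l₀ * (α * cap (g.g12 ^ 2 * ((1 - t ^ 2) * r)) +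
      (1 - α) * cap (g.g10 ^ 2 * ((1 - t ^ 2) * p))) +
      l₁ * (α * cap (g.g10 ^ 2 * ((1 - t ^ 2) * r)) +
      (1 - α) * cap (g.g10 ^ 2 * ((1 - t ^ 2) * p + (K + c * t + Q * t ^ 2)))))
      (Set.Icc (0 : ℝ) 1) 0 := by
    rintro t ⟨ht0, ht1⟩
    have ht2 : t ^ 2 ≤ 1 := pow_le_one₀ ht0 ht1
    have hw := convex_powerSimplex P1 α hv (vertex_thd_mem hP1.le hα) (sub_nonneg.2 ht2)
      (sq_nonneg t) (by ring)
    have hle := hmax _ hw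
    have hS := a5_mul_sq g P2 α Q ht0
    have hS0 := a5_mul_sq g P2 α Q le_rfl
    simp only [mul_zero, ne_eq, OfNat.ofNat_ne_zero, not_false_eq_true, zero_pow,
      add_zero] at hS0
    simp only [Prod.smul_mk, Prod.mk_add_mk, smul_eq_mul, mul_zero, add_zero, zero_add, relayJ,
      relayS] at hle
    rw [mul_comm (t ^ 2), hS, hS0] at hle
    simpa using hle
  have hcone : (1 : ℝ) ∈ posTangentConeAt (Set.Icc (0 : ℝ) 1) 0 :=
    mem_posTangentConeAt_of_segment_subset (by rw [zero_add, segment_eq_Icc zero_le_one])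
  -- At the left end of `[0, 1]` a maximum forces a nonpositive right derivative, yet the only
  -- surviving term is the positive one in `h3`.
  have := hmaxOn.localize.hasFDerivWithinAt_nonpos d.hasFDerivAt.hasFDerivWithinAt hcone
  have hlog : 0 < Real.log 2 := Real.log_pos one_lt_two
  simp at this
  have h3 : 0 < l₁ * ((1 - α) * ((Real.log 2)⁻¹ * ((g.g10 ^ 2)⁻¹ + (p + K))⁻¹ * c)) := by
    positivity
  linarith

/-- The rate multipliers are the separation weights, `lam2` is the derivative of the weighted bound
in the direction of the optimal powers per unit of power, and the `mu` are the resulting slacks at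
the vertices. -/
theorem IsOptimal.exists_isKKT {g : Gains} (hg : g.Pos) {P1 P2 α : ℝ} (hP1 : 0 < P1)
    (hP2 : 0 < P2) (hα0 : 0 < α) (hα : α < 1) {x : Point} (hx : IsOptimal g P1 P2 α x) :
    ∃ m : Multipliers, IsKKT g P1 P2 α x m := by
  have hβ := sub_pos.2 hα
  obtain ⟨hv, hmax, hR⟩ := (isOptimal_iff hg x).1 hx
  obtain ⟨-, hRJ, hRS⟩ := (Point.feasible_iff hg P1 P2 α x).1 hx.1
  have hsub : powerSimplex P1 α ⊆ orthant := fun _ h => h.1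
  obtain ⟨l₀, l₁, h0, h1, hl, hle⟩ := exists_convexCombination_le
    ((concaveOn_relayJ g hα0.le hα.le).subset hsub (convex_powerSimplex P1 α))
    ((concaveOn_relayS hg hP2 hα0.le hα).subset hsub (convex_powerSimplex P1 α)) ⟨_, hv⟩
    (R := x.R) (fun w hw => (hmax hw).trans_eq hR.symm)
  have hs0 := mul_le_mul_of_nonneg_left hRJ h0
  have hs1 := mul_le_mul_of_nonneg_left hRS h1
  have hxle := hle _ hv
  have hlR : l₀ * x.R + l₁ * x.R = x.R := by rw [← add_mul, hl, one_mul]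
  have hmax' : ∀ w ∈ powerSimplex P1 α, l₀ * relayJ g α w + l₁ * relayS g P2 α w ≤
      l₀ * relayJ g α x.powers + l₁ * relayS g P2 α x.powers := fun w hw =>
    (hle w hw).trans (by linarith)
  have hlog : 0 < Real.log 2 := Real.log_pos one_lt_two
  have hc : 0 < (g.g10 ^ 2)⁻¹ := by have := hg.2.2.1; positivity
  have hc12 : 0 < (g.g12 ^ 2)⁻¹ := by have := hg.1; positivity
  -- With weight zero on `S₄` its possible failure of differentiability is harmless; with positive
  -- weight, `ρ13 > 0`.
  obtain ⟨D, hD, hDp⟩ : ∃ D : ℝ × ℝ × ℝ →L[ℝ] ℝ,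
      HasFDerivAt (fun w => l₀ * relayJ g α w + l₁ * relayS g P2 α w) D x.powers ∧
        ∀ w ∈ orthant, 0 ≤ D w := by
    obtain ⟨DJ, hDJ, eJ⟩ := hasFDerivAt_relayJ hg α hv.1
    have hJ0 : ∀ w ∈ orthant, 0 ≤ DJ w := by
      rintro w ⟨w1, w2, w3⟩
      have := hv.1.1
      have := hv.1.2.1
      rw [eJ, a3]
      positivity
    rcases h1.eq_or_lt with h | h
    · refine ⟨l₀ • DJ, ?_, fun w hw => mul_nonneg h0 (hJ0 w hw)⟩
      simpa [← h] using hDJ.const_mul l₀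
    · have hq := thd_pos_of_isMaxOn hg hP1 hP2 hα h hv hmax'
      obtain ⟨DS, hDS, eS⟩ := hasFDerivAt_relayS hg hP2 hα hv.1 hq
      refine ⟨l₀ • DJ + l₁ • DS, (hDJ.const_mul l₀).add (hDS.const_mul l₁), fun w hw =>
        add_nonneg (mul_nonneg h0 (hJ0 w hw)) (mul_nonneg h1 ?_)⟩
      obtain ⟨w1, w2, w3⟩ := hw
      have := hv.1.2.1
      have := snr_pos hg hP2 hα hv.1
      have := hg.2.2.1
      have := hg.2.2.2
      refine (eS w).symm ▸ ?_
      rw [a2, a4]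
      positivity
  have hDle : ∀ w ∈ powerSimplex P1 α, D w ≤ D x.powers := by
    intro w hw
    have hm : IsMaxOn (fun w => l₀ * relayJ g α w + l₁ * relayS g P2 α w) (powerSimplex P1 α)
      x.powers := hmax'
    have := hm.localize.hasFDerivWithinAt_nonpos hD.hasFDerivWithinAt
      (sub_mem_posTangentConeAt_of_segment_subset ((convex_powerSimplex P1 α).segment_subset hv hw))
    rw [map_sub] at this
    linarith
  have hDeq : ∀ a b c : ℝ, D (a, b, c) = a * D (1, 0, 0) + b * D (0, 1, 0) + c * D (0, 0, 1) := by
    intro a b c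
    have e : ((a, b, c) : ℝ × ℝ × ℝ) = a • (1, 0, 0) + b • (0, 1, 0) + c • (0, 0, 1) := by simp
    rw [e]
    simp only [map_add, map_smul, smul_eq_mul]
  set G₁ := D (1, 0, 0)
  set G₂ := D (0, 1, 0)
  set G₃ := D (0, 0, 1)
  set L := D x.powers / P1
  have hL : L * P1 = D x.powers := div_mul_cancel₀ _ hP1.ne'
  have m1 : 0 ≤ L * (1 - α) - G₁ := by
    have := hDle _ (vertex_fst_mem hP1.le hα)
    rw [hDeq, ← hL, zero_mul, zero_mul, add_zero, add_zero, div_mul_eq_mul_div,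
      div_le_iff₀ hβ] at this
    nlinarith
  have m2 : 0 ≤ L * α - G₂ := by
    have := hDle _ (vertex_snd_mem hP1.le hα0)
    rw [hDeq, ← hL, zero_mul, zero_mul, add_zero, zero_add, div_mul_eq_mul_div,
      div_le_iff₀ hα0] at this
    nlinarith
  have m3 : 0 ≤ L * (1 - α) - G₃ := by
    have := hDle _ (vertex_thd_mem hP1.le hα)
    rw [hDeq, ← hL, zero_mul, zero_mul, zero_add, zero_add, div_mul_eq_mul_div,
      div_le_iff₀ hβ] at this
    nlinarith
  have n1 := mul_nonneg m1 hv.1.1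
  have n2 := mul_nonneg m2 hv.1.2.1
  have n3 := mul_nonneg m3 hv.1.2.2
  -- The three products are nonnegative and add up to `L * P1 - D x.powers = 0`, so each vanishes:
  -- complementary slackness.
  have hsum : (L * (1 - α) - G₁) * x.powers.1 + (L * α - G₂) * x.powers.2.1 +
      (L * (1 - α) - G₃) * x.powers.2.2 = 0 := by
    have h := hDeq x.powers.1 x.powers.2.1 x.powers.2.2
    rw [show (x.powers.1, x.powers.2.1, x.powers.2.2) = x.powers from rfl, ← hL] at h
    linear_combination L * hv.2 + h
  refine ⟨⟨l₀, l₁, L, L * (1 - α) - G₁, L * α - G₂, L * (1 - α) - G₃⟩, ?_, hx.1, h0, h1,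
    div_nonneg (hDp _ hv.1) hP1.le, m1, m2, m3, ?_, ?_, ?_, ?_, ?_⟩
  -- With these multipliers the Lagrangian is the weighted bound minus its own derivative `D`, plus
  -- a constant; the coefficient of `R` is `1 - l₀ - l₁ = 0`.
  · have hD' : HasFDerivAt (fun z : ℝ × ℝ × ℝ × ℝ => l₀ * relayJ g α z.2 + l₁ * relayS g P2 α z.2)
        (D.comp (ContinuousLinearMap.snd ℝ ℝ (ℝ × ℝ × ℝ))) (x.R, x.ρ10, x.ρ11, x.ρ13) :=
      HasFDerivAt.comp (x.R, x.ρ10, x.ρ11, x.ρ13) (g := fun w => l₀ * relayJ g α w +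
        l₁ * relayS g P2 α w) hD hasFDerivAt_snd
    have hlin : HasFDerivAt (fun z : ℝ × ℝ × ℝ × ℝ => L * P1 -
        D.comp (ContinuousLinearMap.snd ℝ ℝ (ℝ × ℝ × ℝ)) z)
        (-(D.comp (ContinuousLinearMap.snd ℝ ℝ (ℝ × ℝ × ℝ)))) (x.R, x.ρ10, x.ρ11, x.ρ13) :=
      (ContinuousLinearMap.hasFDerivAt _).const_sub _
    have hall := hD'.add hlin
    rw [add_neg_cancel] at hall
    refine hall.congr_of_eventuallyEq (Filter.Eventually.of_forall fun z => ?_)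
    have h := hDeq z.2.1 z.2.2.1 z.2.2.2
    rw [show (z.2.1, z.2.2.1, z.2.2.2) = z.2 from rfl] at h
    simp only [lagrangian_eq hg, Pi.add_apply, ContinuousLinearMap.comp_apply,
      ContinuousLinearMap.coe_snd']
    rw [h]
    linear_combination (-z.1) * hl
  · change _ * x.powers.1 = 0
    linarith
  · change _ * x.powers.2.1 = 0
    linarith
  · change _ * x.powers.2.2 = 0
    linarith
  · rw [Point.J1_eq]
    linarith
  · rw [Point.S4_eq hg]
    linarith


/-! ### Stationarity equations -/

/-- On the simplex the Lagrangian at fixed `R` is the weighted bound plus constants and nonnegative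
`mu` terms that vanish at `x`, so `x` maximizes the weighted bound. -/
theorem IsKKT.thd_pos {g : Gains} (hg : g.Pos) {P1 P2 α : ℝ} (hP1 : 0 < P1) (hP2 : 0 < P2)
    (hα0 : 0 < α) (hα : α < 1) {x : Point} {m : Multipliers} (h : IsKKT g P1 P2 α x m)
    (hm : 0 < m.lam1) : 0 < x.ρ13 := by
  obtain ⟨hd, hf, h0, h1, h2, k0, k1, k3, c0, c1, c3, s0, s1⟩ := h
  have hx := (Point.feasible_iff hg P1 P2 α x).1 hf
  have hmax := (concaveOn_lagrangian hg P1 hP2 hα0.le hα h0 h1).isMaxOn_of_hasFDerivAt_zero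
    (x := (x.R, x.ρ10, x.ρ11, x.ρ13)) hx.1.1 hd
  refine thd_pos_of_isMaxOn (v := x.powers) (l₀ := m.lam0) hg hP1 hP2 hα hm hx.1 fun w hw => ?_
  have hle : lagrangian g P1 P2 α m (x.R, w) ≤ lagrangian g P1 P2 α m (x.R, x.powers) :=
    hmax (Set.mem_preimage.2 hw.1)
  simp only [lagrangian_eq hg] at hle
  rw [hx.1.2, hw.2] at hle
  have e3 := mul_nonneg k0 hw.1.1
  have e4 := mul_nonneg k1 hw.1.2.1
  have e5 := mul_nonneg k3 hw.1.2.2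
  have f3 : m.mu10 * x.powers.1 = 0 := c0
  have f4 : m.mu11 * x.powers.2.1 = 0 := c1
  have f5 : m.mu13 * x.powers.2.2 = 0 := c3
  linarith

/-- The partial derivatives in `R`, `ρ10`, `ρ11`, `ρ13`, the last three multiplied by `log 2` over
the duration of the phase so that all share one right-hand side. For `lam1 = 0` the terms with `a4`
and `a5` carry the factor zero. -/
theorem IsKKT.stationary {g : Gains} (hg : g.Pos) {P1 P2 α : ℝ} (hP1 : 0 < P1) (hP2 : 0 < P2)
    (hα0 : 0 < α) (hα : α < 1) {x : Point} {m : Multipliers} (h : IsKKT g P1 P2 α x m) :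
    m.lam0 + m.lam1 = 1 ∧
    m.lam0 / ((g.g10 ^ 2)⁻¹ + x.ρ10) + m.lam1 / ((g.g10 ^ 2)⁻¹ + (x.ρ10 + a5 g P2 α x.ρ13))
      + m.mu10 * (Real.log 2 / (1 - α)) = m.lam2 * Real.log 2 ∧
    m.lam0 / a3 g x.ρ11 + m.lam1 / a2 g x.ρ11 + m.mu11 * (Real.log 2 / α)
      = m.lam2 * Real.log 2 ∧
    m.lam1 / ((g.g10 ^ 2)⁻¹ + (x.ρ10 + a5 g P2 α x.ρ13)) * a4 g P2 α x.ρ13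
      + m.mu13 * (Real.log 2 / (1 - α)) = m.lam2 * Real.log 2 := by
  have hβ := sub_pos.2 hα
  have hlog : 0 < Real.log 2 := Real.log_pos one_lt_two
  have hx := (Point.feasible_iff hg P1 P2 α x).1 h.2.1
  have hv := hx.1.1
  obtain ⟨DJ, hDJ, eJ⟩ := hasFDerivAt_relayJ hg α hv
  obtain ⟨DS, hDS, eS⟩ : ∃ D : ℝ × ℝ × ℝ →L[ℝ] ℝ,
      HasFDerivAt (fun w => m.lam1 * relayS g P2 α w) D x.powers ∧ ∀ w, D w = m.lam1 * (
      (1 - α) / (((g.g10 ^ 2)⁻¹ + (x.powers.1 + a5 g P2 α x.powers.2.2)) * Real.log 2) *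
          (w.1 + a4 g P2 α x.powers.2.2 * w.2.2)
        + α / (a2 g x.powers.2.1 * Real.log 2) * w.2.1) := by
    rcases h.2.2.2.1.eq_or_lt with h1 | h1
    · refine ⟨0, ?_, fun w => by simp [← h1]⟩
      simpa [← h1] using hasFDerivAt_const (0 : ℝ) x.powers
    · obtain ⟨DS, hDS, eS⟩ := hasFDerivAt_relayS hg hP2 hα hv (h.thd_pos hg hP1 hP2 hα0 hα h1)
      exact ⟨m.lam1 • DS, hDS.const_mul _, fun w => by simp [eS]⟩
  have hD : HasFDerivAt (fun w => m.lam0 * relayJ g α w + m.lam1 * relayS g P2 α w)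
      (m.lam0 • DJ + DS) x.powers := (hDJ.const_mul m.lam0).add hDS
  have hD' : HasFDerivAt (fun z : ℝ × ℝ × ℝ × ℝ => m.lam0 * relayJ g α z.2 +
      m.lam1 * relayS g P2 α z.2) ((m.lam0 • DJ + DS).comp
      (ContinuousLinearMap.snd ℝ ℝ (ℝ × ℝ × ℝ))) (x.R, x.ρ10, x.ρ11, x.ρ13) :=
    HasFDerivAt.comp (x.R, x.ρ10, x.ρ11, x.ρ13) (g := fun w => m.lam0 * relayJ g α w +
      m.lam1 * relayS g P2 α w) hD hasFDerivAt_snd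
  let e2 := ContinuousLinearMap.snd ℝ ℝ (ℝ × ℝ × ℝ)
  let e3 := (ContinuousLinearMap.snd ℝ ℝ (ℝ × ℝ)).comp e2
  let Lin : ℝ × ℝ × ℝ × ℝ →L[ℝ] ℝ :=
    (1 - m.lam0 - m.lam1) • ContinuousLinearMap.fst ℝ ℝ (ℝ × ℝ × ℝ)
    + (m.mu10 - m.lam2 * (1 - α)) • (ContinuousLinearMap.fst ℝ ℝ (ℝ × ℝ)).comp e2
    + (m.mu11 - m.lam2 * α) • (ContinuousLinearMap.fst ℝ ℝ ℝ).comp e3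
    + (m.mu13 - m.lam2 * (1 - α)) • (ContinuousLinearMap.snd ℝ ℝ ℝ).comp e3
  have hall := (hD'.add Lin.hasFDerivAt).add_const (m.lam2 * P1)
  have hL : HasFDerivAt (lagrangian g P1 P2 α m)
      ((m.lam0 • DJ + DS).comp (ContinuousLinearMap.snd ℝ ℝ (ℝ × ℝ × ℝ)) + Lin)
      (x.R, x.ρ10, x.ρ11, x.ρ13) := by
    refine hall.congr_of_eventuallyEq (Filter.Eventually.of_forall fun z => ?_)
    simp [lagrangian_eq hg, Lin, e2, e3]
    ring
  have huniq := h.1.unique hL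
  have happ : ∀ z, (0 : ℝ) = (m.lam0 * DJ z.2 + DS z.2) + Lin z := fun z => by
    have := congrArg (fun F : ℝ × ℝ × ℝ × ℝ →L[ℝ] ℝ => F z) huniq
    simpa using this
  have hp : x.powers.1 = x.ρ10 := rfl
  have hr : x.powers.2.1 = x.ρ11 := rfl
  have hq : x.powers.2.2 = x.ρ13 := rfl
  have q0 := happ (1, 0, 0, 0)
  have q1 := happ (0, 1, 0, 0)
  have q2 := happ (0, 0, 1, 0)
  have q3 := happ (0, 0, 0, 1)
  simp [Lin, e2, e3, eJ, eS, hp, hr, hq] at q0 q1 q2 q3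
  have hc : 0 < (g.g10 ^ 2)⁻¹ := by have := hg.2.2.1; positivity
  have hc12 : 0 < (g.g12 ^ 2)⁻¹ := by have := hg.1; positivity
  have hp0 : 0 ≤ x.ρ10 := hv.1
  have hr0 : 0 ≤ x.ρ11 := hv.2.1
  have hA : 0 < (g.g10 ^ 2)⁻¹ + x.ρ10 := by positivity
  have hB : 0 < (g.g10 ^ 2)⁻¹ + (x.ρ10 + a5 g P2 α x.ρ13) := add_pos hc (snr_pos hg hP2 hα hv)
  have h2 : 0 < a2 g x.ρ11 := by rw [a2]; positivity
  have h3 : 0 < a3 g x.ρ11 := by rw [a3]; positivity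
  refine ⟨by linarith, ?_, ?_, ?_⟩
  · clear q0 q2 q3
    generalize (g.g10 ^ 2)⁻¹ + x.ρ10 = A at *
    generalize (g.g10 ^ 2)⁻¹ + (x.ρ10 + a5 g P2 α x.ρ13) = B at *
    have : m.lam0 / A + m.lam1 / B + m.mu10 * (Real.log 2 / (1 - α)) - m.lam2 * Real.log 2 =
      (m.lam0 * ((1 - α) / (A * Real.log 2)) + m.lam1 * ((1 - α) / (B * Real.log 2)) +
        (m.mu10 - m.lam2 * (1 - α))) * (Real.log 2 / (1 - α)) := by field_simp; ring
    rw [← q1, zero_mul] at this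
    linarith
  · clear q0 q1 q3
    generalize a3 g x.ρ11 = A at *
    generalize a2 g x.ρ11 = B at *
    have : m.lam0 / A + m.lam1 / B + m.mu11 * (Real.log 2 / α) - m.lam2 * Real.log 2 =
      (m.lam0 * (α / (A * Real.log 2)) + m.lam1 * (α / (B * Real.log 2)) +
        (m.mu11 - m.lam2 * α)) * (Real.log 2 / α) := by field_simp; ring
    rw [← q2, zero_mul] at this
    linarith
  · clear q0 q1 q2
    generalize (g.g10 ^ 2)⁻¹ + (x.ρ10 + a5 g P2 α x.ρ13) = B at *
    have : m.lam1 / B * a4 g P2 α x.ρ13 + m.mu13 * (Real.log 2 / (1 - α)) -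
        m.lam2 * Real.log 2 =
      (m.lam1 * ((1 - α) / (B * Real.log 2) * a4 g P2 α x.ρ13) +
        (m.mu13 - m.lam2 * (1 - α))) * (Real.log 2 / (1 - α)) := by field_simp; ring
    rw [← q3, zero_mul] at this
    linarith

/-! ### Schemes used by relay designs -/

/-- Without phase 1 power the destination still hears user 2 in phase 3, which only `S₄` counts. -/
theorem relayJ_lt_relayS {g : Gains} (hg : g.Pos) {P2 α : ℝ} (hP2 : 0 < P2) (hα : α < 1)
    {v : ℝ × ℝ × ℝ} (hv : v ∈ orthant) (hr : v.2.1 = 0) : relayJ g α v < relayS g P2 α v := by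
  have h10 := hg.2.2.1
  have hv1 := hv.1
  simp only [relayJ, relayS, hr, mul_zero]
  refine add_lt_add_right (mul_lt_mul_of_pos_left (cap_lt_cap (by positivity) ?_)
    (sub_pos.2 hα)) _
  exact mul_lt_mul_of_pos_left (lt_add_of_pos_right _ (a5_pos hg hP2 hα hv.2.2)) (by positivity)

/-- With no message of user 2 and no second phase, `I5` equals `I3`, `I6` equals `I8`, and `I7` is
at least `I3`, so only three bounds remain. -/
theorem delivers_relayDesign_iff {g : Gains} (hg : g.Pos) {P2 α : ℝ} (hP2 : 0 < P2)
    (hα : α < 1) {x : Point} (hx : x.powers ∈ orthant) {R : ℝ} {s : RateSplit} :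
    Delivers g (relayDesign P2 α x) R s ↔ 0 ≤ s.R10 ∧ 0 ≤ s.R12 ∧ s.R20 = 0 ∧ s.R21 = 0 ∧
      s.R10 + s.R12 = R ∧ s.R12 ≤ α * cap (g.g12 ^ 2 * x.ρ11) ∧
      s.R10 ≤ (1 - α) * cap (g.g10 ^ 2 * x.ρ10) ∧ R ≤ relayS g P2 α x.powers := by
  have hβ := sub_pos.2 hα
  have hp : 0 ≤ x.ρ10 := hx.1
  have hz : (1 - α) * cap (g.g10 ^ 2 * x.ρ10) ≤
      (1 - α) * cap (g.g10 ^ 2 * (x.ρ10 + a5 g P2 α x.ρ13)) := by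
    refine mul_le_mul_of_nonneg_left (cap_le_cap (by positivity)
      (mul_le_mul_of_nonneg_left ?_ (sq_nonneg _))) hβ.le
    exact le_add_of_nonneg_right (a5_pos hg hP2 hα hx.2.2).le
  simp only [Delivers, Decodable, Design.I1, Design.I2, Design.I3, Design.I4, Design.I5,
    Design.I6, Design.I7, Design.I8, zeta_eq hg, Design.α3]
  simp only [relayDesign, mul_zero, cap_zero, add_zero, zero_add, sub_zero, relayS, Point.powers]
  constructor
  · rintro ⟨⟨h1, h2, -, -, h5, -, h7, -, -, -, -, h12⟩, rfl, h20, h21⟩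
    simp only [h20, h21, add_zero] at h12
    exact ⟨h1, h2, h20, h21, rfl, h5, h7, h12⟩
  · rintro ⟨h1, h2, h20, h21, rfl, h5, h7, h12⟩
    simp only [h20, h21, add_zero]
    exact ⟨⟨h1, h2, le_rfl, le_rfl, h5, le_rfl, h7, le_rfl, h7, h12, h7.trans hz, h12⟩,
      trivial, trivial, trivial⟩

theorem exists_delivers {g : Gains} (hg : g.Pos) {P2 α : ℝ} (hP2 : 0 < P2) (hα0 : 0 < α) (hα : α < 1)
    {x : Point} (hx : x.powers ∈ orthant) {R : ℝ} (hR : 0 ≤ R) (hJ : R ≤ relayJ g α x.powers)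
    (hS : R ≤ relayS g P2 α x.powers) : ∃ s, Delivers g (relayDesign P2 α x) R s := by
  have hp : 0 ≤ x.ρ10 := hx.1
  have hr : 0 ≤ x.ρ11 := hx.2.1
  -- The private part takes as much of the rate as phase 3 allows, the cooperative part the rest.
  refine ⟨⟨min R ((1 - α) * cap (g.g10 ^ 2 * x.ρ10)), R - min R ((1 - α) * cap (g.g10 ^ 2 * x.ρ10)),
    0, 0⟩, (delivers_relayDesign_iff hg hP2 hα hx).2 ⟨le_min hR (mul_nonneg (sub_pos.2 hα).le
      (cap_nonneg (by positivity))), sub_nonneg.2 (min_le_left _ _), rfl, rfl, by simp,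
      ?_, min_le_right _ _, hS⟩⟩
  simp only [relayJ, Point.powers] at hJ
  rcases min_choice R ((1 - α) * cap (g.g10 ^ 2 * x.ρ10)) with h | h <;> rw [h]
  · rw [sub_self]
    have h12 := hg.1
    exact mul_nonneg hα0.le (cap_nonneg (by positivity))
  · linarith

section schemes

variable {g : Gains} {P2 α : ℝ} {x : Point} {s : RateSplit}

theorem sent11_relayDesign (hα0 : 0 < α) (hr : 0 < x.ρ11) (h12 : 0 < s.R12) :
    sent11 (relayDesign P2 α x) s = {.w12} := by
  ext m
  simp only [sent11, relayDesign, Set.mem_ofPred_eq, Set.mem_singleton_iff]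
  exact ⟨fun h => h.2.2.1, fun h => by subst h; exact ⟨h12, hα0, rfl, hr⟩⟩

theorem sent23_relayDesign (hP2 : 0 < P2) (hα : α < 1) (h12 : 0 < s.R12) (h21 : s.R21 = 0) :
    sent23 (relayDesign P2 α x) s = {.w12} := by
  have h1 := rho23_pos hP2 hα
  ext m
  cases m <;> simp [sent23, relayDesign, Design.α3, RateSplit.rate, h12, h21, h1, hα]

theorem sent13_relayDesign (hα : α < 1) (h21 : s.R21 = 0) (m : MessagePart) :
    m ∈ sent13 (relayDesign P2 α x) s ↔
      (m = .w10 ∧ 0 < s.R10 ∧ 0 < x.ρ10) ∨ (m = .w12 ∧ 0 < s.R12 ∧ 0 < x.ρ13) := by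
  cases m <;> simp [sent13, relayDesign, Design.α3, RateSplit.rate, h21, hα]

/-- When the total rate is `J₁`, both parts are sent at their largest rates. -/
theorem Delivers.rates_eq (hg : g.Pos) (hP2 : 0 < P2) (hα : α < 1) (hx : x.powers ∈ orthant)
    {R : ℝ} (hR : R = relayJ g α x.powers) (h : Delivers g (relayDesign P2 α x) R s) :
    s.R12 = α * cap (g.g12 ^ 2 * x.ρ11) ∧ s.R10 = (1 - α) * cap (g.g10 ^ 2 * x.ρ10) := by
  obtain ⟨-, -, -, -, h1, h2, h3, -⟩ := (delivers_relayDesign_iff hg hP2 hα hx).1 h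
  simp only [relayJ, Point.powers] at hR
  constructor <;> linarith

theorem relayJ_pos (hg : g.Pos) (hα0 : 0 < α) (hα : α < 1) (hx : x.powers ∈ orthant)
    (hr : 0 < x.ρ11) : 0 < relayJ g α x.powers := by
  have hp : 0 ≤ x.ρ10 := hx.1
  have h12 := hg.1
  exact add_pos_of_pos_of_nonneg (mul_pos hα0 (cap_pos (by simp only [Point.powers]; positivity)))
    (mul_nonneg (sub_pos.2 hα).le (cap_nonneg (by simp only [Point.powers]; positivity)))

theorem usesScheme_pdfRepetition (hg : g.Pos) (hP2 : 0 < P2) (hα0 : 0 < α) (hα : α < 1)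
    (hx : x.powers ∈ orthant) {R : ℝ} (hJ : R = relayJ g α x.powers)
    (hS : R ≤ relayS g P2 α x.powers) (hp : 0 < x.ρ10) (hr : 0 < x.ρ11) (hq : 0 < x.ρ13) :
    UsesScheme g (relayDesign P2 α x) R IsPDFRepetition := by
  refine ⟨exists_delivers hg hP2 hα0 hα hx (hJ ▸ (relayJ_pos hg hα0 hα hx hr).le) hJ.le hS,
    fun s hs => ?_⟩
  have h21 := ((delivers_relayDesign_iff hg hP2 hα hx).1 hs).2.2.2.1
  obtain ⟨e12, e10⟩ := hs.rates_eq hg hP2 hα hx hJ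
  have hg12 := hg.1
  have hg10 := hg.2.2.1
  have p12 : 0 < s.R12 := e12 ▸ mul_pos hα0 (cap_pos (by positivity))
  have p10 : 0 < s.R10 := e10 ▸ mul_pos (sub_pos.2 hα) (cap_pos (by positivity))
  refine ⟨rfl, sent11_relayDesign hα0 hr p12, ?_, sent23_relayDesign hP2 hα p12 h21⟩
  ext m
  rw [sent13_relayDesign hα h21]
  simp [p12, p10, hp, hq]

theorem usesScheme_pdfNoRepetition (hg : g.Pos) (hP2 : 0 < P2) (hα0 : 0 < α) (hα : α < 1)
    (hx : x.powers ∈ orthant) {R : ℝ} (hJ : R = relayJ g α x.powers)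
    (hS : R ≤ relayS g P2 α x.powers) (hp : 0 < x.ρ10) (hr : 0 < x.ρ11) (hq : x.ρ13 = 0) :
    UsesScheme g (relayDesign P2 α x) R IsPDFNoRepetition := by
  refine ⟨exists_delivers hg hP2 hα0 hα hx (hJ ▸ (relayJ_pos hg hα0 hα hx hr).le) hJ.le hS,
    fun s hs => ?_⟩
  have h21 := ((delivers_relayDesign_iff hg hP2 hα hx).1 hs).2.2.2.1
  obtain ⟨e12, e10⟩ := hs.rates_eq hg hP2 hα hx hJ
  have hg12 := hg.1
  have hg10 := hg.2.2.1
  have p12 : 0 < s.R12 := e12 ▸ mul_pos hα0 (cap_pos (by positivity))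
  have p10 : 0 < s.R10 := e10 ▸ mul_pos (sub_pos.2 hα) (cap_pos (by positivity))
  refine ⟨rfl, sent11_relayDesign hα0 hr p12, ?_, sent23_relayDesign hP2 hα p12 h21⟩
  ext m
  rw [sent13_relayDesign hα h21]
  simp [p10, hp, hq]

theorem usesScheme_twoHop (hg : g.Pos) (hP2 : 0 < P2) (hα0 : 0 < α) (hα : α < 1)
    (hx : x.powers ∈ orthant) {R : ℝ} (hJ : R = relayJ g α x.powers)
    (hS : R ≤ relayS g P2 α x.powers) (hp : x.ρ10 = 0) (hr : 0 < x.ρ11) (hq : x.ρ13 = 0) :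
    UsesScheme g (relayDesign P2 α x) R IsTwoHop := by
  refine ⟨exists_delivers hg hP2 hα0 hα hx (hJ ▸ (relayJ_pos hg hα0 hα hx hr).le) hJ.le hS,
    fun s hs => ?_⟩
  have h21 := ((delivers_relayDesign_iff hg hP2 hα hx).1 hs).2.2.2.1
  obtain ⟨e12, e10⟩ := hs.rates_eq hg hP2 hα hx hJ
  have hg12 := hg.1
  have p12 : 0 < s.R12 := e12 ▸ mul_pos hα0 (cap_pos (by positivity))
  exact ⟨rfl, by simp [e10, hp, cap_zero], sent11_relayDesign hα0 hr p12, hp, hq,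
    sent23_relayDesign hP2 hα p12 h21⟩

/-- Since `ρ10 = 0` already forces `R10 = 0`, the rate need not equal `J₁`; this covers `lam0 = 0`.
-/
theorem usesScheme_df (hg : g.Pos) (hP2 : 0 < P2) (hα0 : 0 < α) (hα : α < 1)
    (hx : x.powers ∈ orthant) {R : ℝ} (hR : 0 < R) (hJ : R ≤ relayJ g α x.powers)
    (hS : R ≤ relayS g P2 α x.powers) (hp : x.ρ10 = 0) (hr : 0 < x.ρ11) (hq : 0 < x.ρ13) :
    UsesScheme g (relayDesign P2 α x) R IsDF := by
  refine ⟨exists_delivers hg hP2 hα0 hα hx hR.le hJ hS, fun s hs => ?_⟩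
  obtain ⟨h10, -, -, h21, hsum, -, h3, -⟩ := (delivers_relayDesign_iff hg hP2 hα hx).1 hs
  have e10 : s.R10 = 0 := le_antisymm (by simpa [hp, cap_zero] using h3) h10
  have p12 : 0 < s.R12 := by linarith
  refine ⟨rfl, e10, sent11_relayDesign hα0 hr p12, ?_, sent23_relayDesign hP2 hα p12 h21⟩
  ext m
  rw [sent13_relayDesign hα h21]
  simp [p12, hp, hq]

end schemes


/-! ### The four kinds of KKT points -/

/-- With `A = a₂`, `B = a₃` and `T = a₄ - 1`: eliminating `ρ10` from the power equation gives a
quadratic equation for `A`, of which `A` is the larger root. -/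
theorem eq_larger_root {T A a c p q s r P α b b' : ℝ} (hT : 0 ≤ T) (ha : 0 ≤ a) (hA : 0 < A)
    (haA : a < A) (hα0 : 0 ≤ α) (hα : α ≤ 1) (hAr : A = c + r) (hcp : 0 ≤ c + p)
    (hP : α * r + (1 - α) * (p + q) = P)
    (h : T * (c + p) * A + (c + (p + s)) * (A - a) = (1 + T) * A * (A - a))
    (hb : b = (1 + T) * (P + c - (1 - α) * q) + α * a + (1 - α) * ((1 + T) * a + s))
    (hb' : b' = a * (P + c - (1 - α) * q + (1 - α) * s)) :
    A = (2 * (1 + T))⁻¹ * (b + √(b ^ 2 - 4 * (1 + T) * b')) := by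
  have hβ : 0 ≤ 1 - α := sub_nonneg.2 hα
  have hquad : (1 + T) * A ^ 2 - b * A + b' = 0 := by
    rw [hb, hb', ← hP]
    subst hAr
    linear_combination (-(1 - α)) * h
  have hD : c + (p + s) ≤ (1 + T) * A := by
    have h1 : (c + (p + s)) * (A - a) ≤ ((1 + T) * A) * (A - a) := by
      have : 0 ≤ T * (c + p) * A := by positivity
      linarith
    exact le_of_mul_le_mul_right h1 (sub_pos.2 haA)
  have hb'le : b' ≤ (1 + T) * A ^ 2 := by
    -- Besides `a`, the factor is an average of two quantities that are at most `(1 + T) * A`.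
    have e : b' = a * ((1 - α) * (c + (p + s)) + α * A) := by
      rw [hb', ← hP, hAr]; ring
    have h1 : (1 - α) * (c + (p + s)) + α * A ≤ (1 + T) * A := by
      nlinarith [mul_le_mul_of_nonneg_left hD hβ, mul_nonneg (mul_nonneg hα0 hT) hA.le]
    have h2 := mul_le_mul_of_nonneg_left h1 ha
    have h3 : a * ((1 + T) * A) ≤ A * ((1 + T) * A) :=
      mul_le_mul_of_nonneg_right haA.le (by positivity)
    nlinarith
  -- By the quadratic equation, `A` times this number is `(1 + T) * A ^ 2 - b'`. Its sign selects
  -- the larger root.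
  have hlarge : 0 ≤ 2 * (1 + T) * A - b := by
    refine nonneg_of_mul_nonneg_left (b := A) ?_ hA
    nlinarith
  have hsq : b ^ 2 - 4 * (1 + T) * b' = (2 * (1 + T) * A - b) ^ 2 := by
    linear_combination (-4 * (1 + T)) * hquad
  rw [hsq, Real.sqrt_sq hlarge]
  field_simp
  ring

section cases

variable {g : Gains} {P1 P2 α : ℝ} {x : Point} {m : Multipliers}

/-- Putting all of user 1's power into phase 1 already makes both bounds positive. -/
theorem IsOptimal.rate_pos (hg : g.Pos) (hP1 : 0 < P1) (hP2 : 0 < P2) (hα0 : 0 < α)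
    (hα : α < 1) (h : IsOptimal g P1 P2 α x) : 0 < x.R := by
  have hv := vertex_snd_mem hP1.le hα0 (P1 := P1)
  have h12 := hg.1
  have h10 := hg.2.2.1
  have hβ := sub_pos.2 hα
  have hmax := ((isOptimal_iff hg x).1 h).2.1 hv
  rw [← ((isOptimal_iff hg x).1 h).2.2] at hmax
  refine lt_of_lt_of_le (lt_min ?_ ?_) hmax
  · refine add_pos_of_pos_of_nonneg (mul_pos hα0 (cap_pos ?_)) (mul_nonneg hβ.le (cap_nonneg ?_))
    all_goals simp only; positivity
  · refine add_pos_of_nonneg_of_pos (mul_nonneg hα0.le (cap_nonneg ?_)) (mul_pos hβ (cap_pos ?_))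
    · simp only; positivity
    · exact mul_pos (by positivity) (snr_pos hg hP2 hα hv.1)

/-- Complementary slackness gives `R = S₄`, whereas `ρ11 = 0` would give `R ≤ J₁ < S₄`. -/
theorem IsKKT.snd_pos (hg : g.Pos) (hP2 : 0 < P2) (hα : α < 1) (h : IsKKT g P1 P2 α x m)
    (hm : 0 < m.lam1) : 0 < x.ρ11 := by
  obtain ⟨-, hf, h0, h1, h2, k0, k1, k3, c0, c1, c3, s0, s1⟩ := h
  have hx := (Point.feasible_iff hg P1 P2 α x).1 hf
  refine lt_of_le_of_ne hx.1.1.2.1 fun hr => ?_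
  have hlt := relayJ_lt_relayS hg hP2 hα hx.1.1 (Eq.symm hr)
  rw [Point.S4_eq hg] at s1
  have := (mul_eq_zero.1 s1).resolve_left hm.ne'
  linarith [hx.2.1]

theorem a1_nonneg (hg : g.Pos) (h : g.g10 ≤ g.g12) : 0 ≤ a1 g := by
  have h10 := hg.2.2.1
  rw [a1, sub_nonneg]
  exact inv_anti₀ (by positivity) (pow_le_pow_left₀ h10.le h 2)

theorem IsKKT.case2a (hg : g.Pos) (hP1 : 0 < P1) (hP2 : 0 < P2) (hα0 : 0 < α) (hα : α < 1)
    (hle : g.g10 ≤ g.g12) (h : IsKKT g P1 P2 α x m) (hc : Case2a m) :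
    Case2aConclusion g P1 P2 α x m := by
  obtain ⟨hm, hmu10⟩ := hc
  have hβ := sub_pos.2 hα
  have hq := h.thd_pos hg hP1 hP2 hα0 hα hm
  have hr := h.snd_pos hg hP2 hα hm
  obtain ⟨-, E1, E2, E3⟩ := h.stationary hg hP1 hP2 hα0 hα
  have hRpos := (h.isOptimal hg hP2 hα0.le hα).rate_pos hg hP1 hP2 hα0 hα
  obtain ⟨-, hf, h0, h1, h2, k0, k1, k3, c0, c1, c3, s0, s1⟩ := h
  have hx := (Point.feasible_iff hg P1 P2 α x).1 hf
  have hp : 0 ≤ x.ρ10 := hx.1.1.1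
  have hP : α * x.ρ11 + (1 - α) * (x.ρ10 + x.ρ13) = P1 := hx.1.2
  have hmu11 : m.mu11 = 0 := (mul_eq_zero.1 c1).resolve_right hr.ne'
  have hmu13 : m.mu13 = 0 := (mul_eq_zero.1 c3).resolve_right hq.ne'
  have hg12 := hg.1
  have hg10 := hg.2.2.1
  have hg20 := hg.2.2.2
  have hs := rho23_pos hP2 hα
  have ha5 := a5_pos hg hP2 hα hq.le
  rw [hmu10, zero_mul, add_zero] at E1
  rw [hmu11, zero_mul, add_zero] at E2
  rw [hmu13, zero_mul, add_zero] at E3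
  have ha1 := a1_nonneg hg hle
  set T := g.g20 / g.g10 * √(rho23 P2 α / x.ρ13) with hTdef
  have hT : 0 < T := by positivity
  have ha4 : a4 g P2 α x.ρ13 = 1 + T := rfl
  set c := (g.g10 ^ 2)⁻¹ with hcdef
  have hcpos : 0 < c := by positivity
  have hc12 : 0 < (g.g12 ^ 2)⁻¹ := by positivity
  set s := a5 g P2 α x.ρ13 with hsdef
  set A := a2 g x.ρ11 with hAdef
  have hAr : A = c + x.ρ11 := rfl
  have hA : 0 < A := by rw [hAr]; positivity
  have hB : a3 g x.ρ11 = A - a1 g := by rw [hAr, a3, a1]; ring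
  have hBpos : 0 < A - a1 g := by rw [← hB, a3]; positivity
  rw [ha4] at E3
  rw [hB] at E2
  -- Equating the conditions for `ρ10` and `ρ13` fixes the ratio of the rate multipliers; inserted
  -- into the condition for `ρ11`, it leaves the equation `hkey` between the powers alone.
  have hl0 : m.lam0 = m.lam1 * T * (c + x.ρ10) / (c + (x.ρ10 + s)) := by
    have e : m.lam0 / (c + x.ρ10) = m.lam1 / (c + (x.ρ10 + s)) * T := by linarith
    rw [div_eq_iff (by positivity)] at e
    rw [e]
    ring
  have hl0pos : 0 < m.lam0 := by rw [hl0]; positivity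
  have hkey : T * (c + x.ρ10) * A + (c + (x.ρ10 + s)) * (A - a1 g) =
      (1 + T) * A * (A - a1 g) := by
    have e := E2.trans E3.symm
    rw [hl0] at e
    field_simp at e
    linarith
  have hRJ : x.R = x.J1 g P2 α :=
    sub_eq_zero.1 ((mul_eq_zero.1 s0).resolve_left hl0pos.ne')
  have hRS : x.R = x.S4 g P2 α := sub_eq_zero.1 ((mul_eq_zero.1 s1).resolve_left hm.ne')
  have hRJ' := hRJ
  have hRS' := hRS
  rw [Point.J1_eq] at hRJ'
  rw [Point.S4_eq hg] at hRS'
  have hrho11 : x.ρ11 = rho11Of g P1 P2 α x.ρ13 := by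
    have e := eq_larger_root (b := b1 g P1 P2 α x.ρ13) (b' := b2 g P1 P2 α x.ρ13) hT.le ha1 hA
      (sub_pos.1 hBpos) hα0.le hα.le hAr (by positivity) hP hkey rfl (by
        rw [b2, hsdef, a5]; ring)
    rw [rho11Of, ha4, ← e, hAr]
    ring
  have hrho10 : x.ρ10 = rho10Of g P2 α x.ρ11 x.ρ13 := by
    rw [rho10Of, ← hTdef, ← hsdef, ← hAdef, hB, ← hcdef, eq_sub_iff_add_eq, eq_inv_mul_iff_mul_eq₀
      (by positivity)]
    field_simp
    linarith
  have hf2 : f2 g P1 P2 α x.ρ13 = 0 := by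
    -- This is `J₁ = S₄` rewritten; it turns `f2 = 0` into the power equality.
    have hf1 : f1 g P2 α x.ρ10 x.ρ11 x.ρ13 / (1 - α) = cap (g.g10 ^ 2 * x.ρ10) := by
      rw [div_eq_iff hβ.ne', f1]
      have e := hRS'.symm.trans hRJ'
      simp only [relayJ, relayS, Point.powers] at e
      linarith
    simp only [f2]
    rw [← hrho11, ← hrho10, hf1, two_rpow_cap (by positivity), ← hP]
    field_simp
    ring
  refine ⟨hl0pos, hRJ, hRS, hq, hf2, hrho11, hrho10, fun hp' => ?_, fun hp' => ?_⟩
  · exact usesScheme_pdfRepetition hg hP2 hα0 hα hx.1.1 hRJ' hx.2.2 hp' hr hq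
  · exact usesScheme_df hg hP2 hα0 hα hx.1.1 hRpos hx.2.1 hx.2.2 hp' hr hq

theorem IsKKT.case2b (hg : g.Pos) (hP1 : 0 < P1) (hP2 : 0 < P2) (hα0 : 0 < α) (hα : α < 1)
    (h : IsKKT g P1 P2 α x m) (hc : Case2b m) : Case2bConclusion g P1 P2 α x m := by
  obtain ⟨hm, hmu10⟩ := hc
  have hβ := sub_pos.2 hα
  have hq := h.thd_pos hg hP1 hP2 hα0 hα hm
  have hr := h.snd_pos hg hP2 hα hm
  obtain ⟨E0, E1, E2, E3⟩ := h.stationary hg hP1 hP2 hα0 hα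
  have hRpos := (h.isOptimal hg hP2 hα0.le hα).rate_pos hg hP1 hP2 hα0 hα
  obtain ⟨-, hf, h0, h1, h2, k0, k1, k3, c0, c1, c3, s0, s1⟩ := h
  have hx := (Point.feasible_iff hg P1 P2 α x).1 hf
  have hp : x.ρ10 = 0 := (mul_eq_zero.1 c0).resolve_left hmu10.ne'
  have hP : α * x.ρ11 + (1 - α) * (x.ρ10 + x.ρ13) = P1 := hx.1.2
  have hmu11 : m.mu11 = 0 := (mul_eq_zero.1 c1).resolve_right hr.ne'
  have hmu13 : m.mu13 = 0 := (mul_eq_zero.1 c3).resolve_right hq.ne'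
  have hg12 := hg.1
  have hg10 := hg.2.2.1
  have ha5 := a5_pos hg hP2 hα hq.le
  have hRS : x.R = x.S4 g P2 α := sub_eq_zero.1 ((mul_eq_zero.1 s1).resolve_left hm.ne')
  have hRS' := hRS
  rw [Point.S4_eq hg] at hRS'
  have hr_eq : x.ρ11 = α⁻¹ * (P1 - (1 - α) * x.ρ13) := by
    rw [← hP, hp]
    field_simp
    ring
  refine ⟨hRS, hp, hq, hr_eq, fun hl0 => ?_, fun hl0 => ?_, ?_⟩
  · have hRJ : x.R = x.J1 g P2 α := sub_eq_zero.1 ((mul_eq_zero.1 s0).resolve_left hl0.ne')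
    have hRJ' := hRJ
    rw [Point.J1_eq] at hRJ'
    refine ⟨hRJ, ?_⟩
    have e := hRS'.symm.trans hRJ'
    simp only [relayJ, relayS, Point.powers, hp, mul_zero, zero_add, cap_zero, add_zero] at e
    have hf3 : f3 g P2 α x.ρ13 = cap (g.g12 ^ 2 * x.ρ11) - cap (g.g10 ^ 2 * x.ρ11) := by
      rw [f3, div_mul_eq_mul_div, div_eq_iff hα0.ne']
      linarith
    -- With equal gains, `J₁ = S₄` would leave no room for the positive phase 3 term. This keeps the
    -- quotient in `f4` from being `0 / 0`.
    have hne : g.g10 ^ 2 - g.g12 ^ 2 ≠ 0 := by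
      intro h'
      rw [← sub_eq_zero.1 h'] at e
      have : 0 < (1 - α) * cap (g.g10 ^ 2 * a5 g P2 α x.ρ13) :=
        mul_pos hβ (cap_pos (by positivity))
      linarith
    have h2f3 : (2 : ℝ) ^ f3 g P2 α x.ρ13 - g.g12 ^ 2 / g.g10 ^ 2 =
        (1 - g.g12 ^ 2 / g.g10 ^ 2) / (1 + g.g10 ^ 2 * x.ρ11) := by
      rw [hf3, Real.rpow_sub two_pos, two_rpow_cap (by positivity), two_rpow_cap (by positivity)]
      field_simp
      ring
    have hne' : 1 - g.g12 ^ 2 / g.g10 ^ 2 ≠ 0 := by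
      intro h'
      refine hne ?_
      rwa [sub_eq_zero, eq_div_iff (by positivity), one_mul, ← sub_eq_zero] at h'
    rw [f4, h2f3, div_div_cancel₀ hne', div_eq_inv_mul, ← hr_eq]
    field_simp
    ring
  · have hl1 : m.lam1 = 1 := by linarith
    rw [hmu11, hl0, hl1, zero_mul, add_zero, zero_div, zero_add] at E2
    rw [hmu13, hl1, zero_mul, add_zero, hp, zero_add] at E3
    have e := E3.trans E2.symm
    have hc0 : 0 < (g.g10 ^ 2)⁻¹ := by positivity
    have hA : 0 < a2 g x.ρ11 := by rw [a2]; positivity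
    generalize (g.g10 ^ 2)⁻¹ + a5 g P2 α x.ρ13 = D at *
    have hD : D ≠ 0 := by
      rintro rfl
      rw [div_zero, zero_mul] at e
      exact (one_div_pos.2 hA).ne e
    field_simp at e
    exact e
  · exact usesScheme_df hg hP2 hα0 hα hx.1.1 hRpos hx.2.1 hx.2.2 hp hr hq

/-- Facts common to the KKT points at which `S₄` has no multiplier. -/
theorem IsKKT.thd_eq_zero (hg : g.Pos) (hP1 : 0 < P1) (hP2 : 0 < P2) (hα0 : 0 < α) (hα : α < 1)
    (h : IsKKT g P1 P2 α x m) (hm : m.lam1 = 0) :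
    m.lam0 = 1 ∧ 0 < m.mu13 ∧ x.ρ13 = 0 ∧ x.R = x.J1 g P2 α := by
  have hβ := sub_pos.2 hα
  have hlog : 0 < Real.log 2 := Real.log_pos one_lt_two
  obtain ⟨E0, E1, -, E3⟩ := h.stationary hg hP1 hP2 hα0 hα
  obtain ⟨-, hf, h0, h1, h2, k0, k1, k3, c0, c1, c3, s0, s1⟩ := h
  have hx := (Point.feasible_iff hg P1 P2 α x).1 hf
  have hp : 0 ≤ x.ρ10 := hx.1.1.1
  have hg10 := hg.2.2.1
  have hl0 : m.lam0 = 1 := by linarith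
  rw [hm, zero_div, hl0, add_zero] at E1
  rw [hm, zero_div, zero_mul, zero_add] at E3
  have h3 : 0 < 1 / ((g.g10 ^ 2)⁻¹ + x.ρ10) := by positivity
  have h4 : 0 ≤ m.mu10 * (Real.log 2 / (1 - α)) := by positivity
  -- Without `S₄` nothing rewards `ρ13`, so `mu13` alone must match the power price, which is
  -- positive by the equation for `ρ10`.
  have hmu13 : 0 < m.mu13 :=
    pos_of_mul_pos_left (a := m.mu13) (b := Real.log 2 / (1 - α)) (by linarith) (by positivity)
  exact ⟨hl0, hmu13, (mul_eq_zero.1 c3).resolve_left hmu13.ne',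
    sub_eq_zero.1 ((mul_eq_zero.1 s0).resolve_left (by rw [hl0]; exact one_ne_zero))⟩

/-- This is water-filling over two parallel channels with noise levels `g12⁻²` and `g10⁻²`; `a1` is
the difference of the levels. -/
theorem IsKKT.case3a (hg : g.Pos) (hP1 : 0 < P1) (hP2 : 0 < P2) (hα0 : 0 < α) (hα : α < 1)
    (hle : g.g10 ≤ g.g12) (h : IsKKT g P1 P2 α x m) (hc : Case3a m) :
    Case3aConclusion g P1 P2 α x m := by
  obtain ⟨hm, hmu10⟩ := hc
  have hβ := sub_pos.2 hα
  have hlog : 0 < Real.log 2 := Real.log_pos one_lt_two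
  obtain ⟨hl0, hmu13, hq, hRJ⟩ := h.thd_eq_zero hg hP1 hP2 hα0 hα hm
  obtain ⟨-, E1, E2, -⟩ := h.stationary hg hP1 hP2 hα0 hα
  obtain ⟨-, hf, h0, h1, h2, k0, k1, k3, c0, c1, c3, s0, s1⟩ := h
  have hx := (Point.feasible_iff hg P1 P2 α x).1 hf
  have hp : 0 ≤ x.ρ10 := hx.1.1.1
  have hr0 : 0 ≤ x.ρ11 := hx.1.1.2.1
  have hP : α * x.ρ11 + (1 - α) * (x.ρ10 + x.ρ13) = P1 := hx.1.2
  have hg12 := hg.1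
  have hg10 := hg.2.2.1
  have hRJ' := hRJ
  rw [Point.J1_eq] at hRJ'
  rw [hm, zero_div, hl0, hmu10, zero_mul, add_zero, add_zero] at E1
  rw [hm, zero_div, hl0, add_zero] at E2
  rw [hq, add_zero] at hP
  have hc0 : 0 < (g.g10 ^ 2)⁻¹ := by positivity
  have hc12 : 0 < (g.g12 ^ 2)⁻¹ := by positivity
  have ha3 : 0 < a3 g x.ρ11 := by rw [a3]; positivity
  have hcp : 0 < (g.g10 ^ 2)⁻¹ + x.ρ10 := by positivity
  have hle' : (g.g10 ^ 2)⁻¹ + x.ρ10 ≤ a3 g x.ρ11 := by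
    rw [← one_div_le_one_div ha3 hcp, E1, ← E2]
    exact le_add_of_nonneg_right (by positivity)
  -- If the better channel, that to user 2, got no power, `hle'` would leave none for `ρ10` either,
  -- contradicting `P1 > 0`.
  have hr : 0 < x.ρ11 := by
    refine lt_of_le_of_ne hr0 fun hr => ?_
    have ha1 := a1_nonneg hg hle
    rw [a3, ← hr, add_zero] at hle'
    rw [a1] at ha1
    have : x.ρ10 = 0 := by linarith
    rw [this, ← hr] at hP
    linarith
  have hmu11 : m.mu11 = 0 := (mul_eq_zero.1 c1).resolve_right hr.ne'
  rw [hmu11, zero_mul, add_zero] at E2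
  have e : (g.g10 ^ 2)⁻¹ + x.ρ10 = a3 g x.ρ11 := by
    have := E1.trans E2.symm
    rwa [one_div, one_div, inv_inj] at this
  have e' : x.ρ11 = x.ρ10 + a1 g := by
    rw [a3] at e
    rw [a1]
    linarith
  refine ⟨hl0 ▸ one_pos, hmu13, hRJ, hq, ?_, ?_, fun hp' => ?_, fun hp' => ?_⟩
  · linear_combination hP + (1 - α) * e'
  · linear_combination hP - α * e'
  · exact usesScheme_pdfNoRepetition hg hP2 hα0 hα hx.1.1 hRJ' hx.2.2 hp' hr hq
  · exact usesScheme_twoHop hg hP2 hα0 hα hx.1.1 hRJ' hx.2.2 hp' hr hq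

theorem IsKKT.case3b (hg : g.Pos) (hP1 : 0 < P1) (hP2 : 0 < P2) (hα0 : 0 < α) (hα : α < 1)
    (h : IsKKT g P1 P2 α x m) (hc : Case3b m) : Case3bConclusion g P1 P2 α x m := by
  obtain ⟨hm, hmu10⟩ := hc
  obtain ⟨hl0, hmu13, hq, hRJ⟩ := h.thd_eq_zero hg hP1 hP2 hα0 hα hm
  obtain ⟨-, hf, h0, h1, h2, k0, k1, k3, c0, c1, c3, s0, s1⟩ := h
  have hx := (Point.feasible_iff hg P1 P2 α x).1 hf
  have hp : x.ρ10 = 0 := (mul_eq_zero.1 c0).resolve_left hmu10.ne'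
  have hP : α * x.ρ11 + (1 - α) * (x.ρ10 + x.ρ13) = P1 := hx.1.2
  have hr : x.ρ11 = P1 / α := by
    rw [hp, hq] at hP
    rw [eq_div_iff hα0.ne']
    linarith
  have hRJ' := hRJ
  rw [Point.J1_eq] at hRJ'
  exact ⟨hl0 ▸ one_pos, hmu13, hRJ, hq, hp, hr,
    usesScheme_twoHop hg hP2 hα0 hα hx.1.1 hRJ' hx.2.2 hp (hr ▸ div_pos hP1 hα0) hq⟩

/-- If `S₄` has a positive multiplier, then `J₁ = S₄` for some valid power allocation. -/
theorem IsKKT.exists_J1_eq_S4 (hg : g.Pos) (hP1 : 0 < P1) (hP2 : 0 < P2) (hα : α < 1)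
    (h : IsKKT g P1 P2 α x m) (hm : 0 < m.lam1) :
    ∃ y : Point, y.ValidPower P1 α ∧ y.J1 g P2 α = y.S4 g P2 α := by
  have hx := (Point.feasible_iff hg P1 P2 α x).1 h.2.1
  have hRS : x.R = x.S4 g P2 α := sub_eq_zero.1
    ((mul_eq_zero.1 h.2.2.2.2.2.2.2.2.2.2.2.2).resolve_left hm.ne')
  rw [Point.S4_eq hg] at hRS
  have hw := vertex_fst_mem hP1.le hα (P1 := P1)
  have hsub : powerSimplex P1 α ⊆ orthant := fun _ h => h.1
  -- Intermediate values on the connected simplex: `J₁ < S₄` when all power is in `ρ10`, and `S₄ = R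
  -- ≤ J₁` at the KKT point.
  obtain ⟨v, hv, e⟩ := (convex_powerSimplex P1 α).isPreconnected.intermediate_value₂ hw hx.1
    ((continuousOn_relayJ g α).mono hsub) ((continuousOn_relayS hg hP2 hα).mono hsub)
    (relayJ_lt_relayS hg hP2 hα hw.1 rfl).le (hRS ▸ hx.2.1)
  refine ⟨⟨0, v.1, v.2.1, v.2.2⟩, (Point.validPower_iff _ _ _).2 hv, ?_⟩
  rw [Point.J1_eq, Point.S4_eq hg]
  exact e

end cases


/-! ### Reduction of the three-phase scheme to the relay problem -/

theorem relayDesign_feasible {P1 P2 α : ℝ} (hP2 : 0 < P2) (hα0 : 0 < α) (hα : α < 1) {x : Point}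
    (hx : x.ValidPower P1 α) : (relayDesign P2 α x).Feasible P1 P2 := by
  obtain ⟨h1, h2, h3, h4⟩ := hx
  have hβ := sub_pos.2 hα
  refine ⟨hα0.le, le_rfl, by simpa [relayDesign] using hα.le, h2, le_rfl, h3, le_rfl, h4,
    (rho23_pos hP2 hα).le, ?_, ?_⟩
  · simpa [relayDesign, Design.α3] using h1
  · simp only [relayDesign, Design.α3, rho23]
    field_simp
    ring

theorem relayDesign_inRegion {g : Gains} (hg : g.Pos) {P2 α : ℝ} (hP2 : 0 < P2) (hα : α < 1)
    {x : Point} (hx : x.powers ∈ orthant) (hR : 0 ≤ x.R) (hJ : x.R ≤ relayJ g α x.powers)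
    (hS : x.R ≤ relayS g P2 α x.powers) : (relayDesign P2 α x).InRegion g x.R 0 := by
  have hβ := sub_pos.2 hα
  have hp : 0 ≤ x.ρ10 := hx.1
  have hz : (1 - α) * cap (g.g10 ^ 2 * x.ρ10) ≤
      (1 - α) * cap (g.g10 ^ 2 * (x.ρ10 + a5 g P2 α x.ρ13)) := by
    refine mul_le_mul_of_nonneg_left (cap_le_cap (by positivity)
      (mul_le_mul_of_nonneg_left ?_ (sq_nonneg _))) hβ.le
    exact le_add_of_nonneg_right (a5_pos hg hP2 hα hx.2.2).le
  simp only [relayJ, relayS, Point.powers] at hJ hS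
  simp only [Design.InRegion, Design.J1, Design.J2, Design.S1, Design.S2, Design.S3, Design.S4,
    Design.I1, Design.I2, Design.I3, Design.I4, Design.I5, Design.I6, Design.I7, Design.I8,
    zeta_eq hg, Design.α3]
  simp only [relayDesign, mul_zero, cap_zero, add_zero, zero_add, sub_zero]
  exact ⟨hR, le_rfl, hJ, le_rfl, hJ, hS, by linarith, hS⟩

/-- Spreading the powers of phase 3 over phases 2 and 3, with user 2 silent in phase 2, does not
decrease the bounds `J₁` and `S₄`. -/
theorem exists_feasible_point {g : Gains} (hg : g.Pos) {P1 P2 : ℝ} (hP2 : 0 < P2) {d : Design}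
    (hα : d.α1 < 1) (hd : d.Feasible P1 P2) {R : ℝ} (hR : d.InRegion g R 0) :
    ∃ y : Point, y.Feasible g P1 P2 d.α1 ∧ y.R = R := by
  obtain ⟨h1, h2, h3, h10, h20, h11, h22, h13, h23, hp1, hp2⟩ := hd
  obtain ⟨hR0, -, hJ, -, -, -, -, hS⟩ := hR
  have hβ := sub_pos.2 hα
  have hg10 := hg.2.2.1
  have hg20 := hg.2.2.2
  have h3' : 0 ≤ d.α3 := by rw [Design.α3]; linarith
  have hα3 : d.α2 + d.α3 = 1 - d.α1 := by rw [Design.α3]; ring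
  have hs := rho23_pos hP2 hα
  have hsP : (1 - d.α1) * rho23 P2 d.α1 = P2 := by rw [rho23]; field_simp
  -- The energies of phase 3 are spread evenly over the merged duration `1 - α1`.
  set y : Point := ⟨R, d.α3 * d.ρ10 / (1 - d.α1), d.ρ11, d.α3 * d.ρ13 / (1 - d.α1)⟩
  refine ⟨y, (Point.feasible_iff hg _ _ _ _).2 ⟨⟨⟨by simp only [y, Point.powers]; positivity, h11,
    by simp only [y, Point.powers]; positivity⟩, ?_⟩, ?_, ?_⟩, rfl⟩
  · rw [← hp1]
    simp only [y, Point.powers]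
    field_simp
  · refine hJ.trans ?_
    have := mul_cap_le h3' (show d.α3 ≤ 1 - d.α1 by linarith) hβ
      (show 0 ≤ g.g10 ^ 2 * d.ρ10 by positivity)
    simp only [Design.J1, Design.I1, Design.I3, relayJ, y, Point.powers]
    rw [show d.α3 * (g.g10 ^ 2 * d.ρ10) / (1 - d.α1) = g.g10 ^ 2 * (d.α3 * d.ρ10 / (1 - d.α1)) by
      ring] at this
    linarith
  · rw [Design.S4, Design.I8] at hS
    have hζ : 0 ≤ d.ζ g := by rw [Design.ζ]; positivity
    have hcc := mul_cap_add_mul_cap_le h2 h3' hβ hα3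
      (show 0 ≤ g.g20 ^ 2 * d.ρ22 by positivity) hζ
    have hz := zeta_eq hg P2 d.α1 y
    have hle : (d.α2 * (g.g20 ^ 2 * d.ρ22) + d.α3 * d.ζ g) / (1 - d.α1) ≤
        g.g10 ^ 2 * (y.ρ10 + a5 g P2 d.α1 y.ρ13) := by
      rw [← hz, div_le_iff₀ hβ]
      -- Inside one root this compares the energies `α3 ρ13 · α3 ρ23` and `α3 ρ13 · P2`: user 2
      -- spends at most `P2` on cooperation.
      have hsq : d.α3 * √(d.ρ13 * d.ρ23) ≤ √(y.ρ13 * rho23 P2 d.α1) * (1 - d.α1) := by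
        rw [← Real.sqrt_sq h3', ← Real.sqrt_sq hβ.le, ← Real.sqrt_mul (sq_nonneg _),
          ← Real.sqrt_mul' _ (sq_nonneg _)]
        refine Real.sqrt_le_sqrt ?_
        have e : y.ρ13 * rho23 P2 d.α1 * (1 - d.α1) ^ 2 = d.α3 * d.ρ13 * P2 := by
          simp only [y, rho23]
          field_simp
        have e2 : d.α3 * d.ρ23 ≤ P2 := by
          have := mul_nonneg h2 h22
          have := mul_nonneg h3' h20
          linarith
        rw [e]
        calc d.α3 ^ 2 * (d.ρ13 * d.ρ23) = d.α3 * d.ρ13 * (d.α3 * d.ρ23) := by ring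
          _ ≤ _ := mul_le_mul_of_nonneg_left e2 (by positivity)
      have hsq' := mul_le_mul_of_nonneg_left hsq (show 0 ≤ 2 * g.g10 * g.g20 by positivity)
      have e1 : y.ρ10 * (1 - d.α1) = d.α3 * d.ρ10 := div_mul_cancel₀ _ hβ.ne'
      have e2 : y.ρ13 * (1 - d.α1) = d.α3 * d.ρ13 := div_mul_cancel₀ _ hβ.ne'
      have expand : (relayDesign P2 d.α1 y).ζ g = g.g10 ^ 2 * (y.ρ10 + y.ρ13) +
          g.g20 ^ 2 * (0 + rho23 P2 d.α1) + 2 * g.g10 * g.g20 * √(y.ρ13 * rho23 P2 d.α1) := rfl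
      rw [expand, Design.ζ]
      linear_combination hsq' - g.g10 ^ 2 * e1 - g.g10 ^ 2 * e2 - g.g20 ^ 2 * hsP
        + g.g20 ^ 2 * hp2
    have hmono := mul_le_mul_of_nonneg_left (cap_le_cap (by positivity) hle) hβ.le
    simp only [relayS, Point.powers]
    have : y.ρ11 = d.ρ11 := rfl
    rw [this]
    change R ≤ _
    linarith

theorem IsOptimal.isGreatest {g : Gains} (hg : g.Pos) {P1 P2 α : ℝ}
    (hP2 : 0 < P2) (hα0 : 0 < α) (hα : α < 1) {x : Point} (h : IsOptimal g P1 P2 α x)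
    (hR : 0 ≤ x.R) :
    (relayDesign P2 α x).Feasible P1 P2 ∧ (relayDesign P2 α x).InRegion g x.R 0 ∧
      IsGreatest (individualRatesAt g P1 P2 α) x.R := by
  have hx := (Point.feasible_iff hg P1 P2 α x).1 h.1
  have h1 := relayDesign_feasible hP2 hα0 hα h.1.1
  have h2 := relayDesign_inRegion hg hP2 hα hx.1.1 hR hx.2.1 hx.2.2
  refine ⟨h1, h2, ⟨_, rfl, h1, h2⟩, ?_⟩
  rintro R ⟨d, rfl, hd, hdR⟩
  obtain ⟨y, hy, rfl⟩ := exists_feasible_point hg hP2 hα hd hdR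
  exact h.2 y hy

/-! ### Direct transmission -/

/-- If the link to user 2 is the weaker one, then `J₁ ≤ C(g₁₀² P₁)`, with equality only for direct
transmission. -/
theorem J1_le_cap {g : Gains} (hg : g.Pos) (hlt : g.g12 < g.g10) {P1 Q : ℝ} (hP1 : 0 < P1)
    {d : Design} (hd : d.Feasible P1 Q) :
    d.J1 g ≤ cap (g.g10 ^ 2 * P1) ∧ (cap (g.g10 ^ 2 * P1) ≤ d.J1 g →
      d.α1 = 0 ∧ d.α2 = 0 ∧ d.ρ10 = P1 ∧ d.ρ13 = 0) := by
  obtain ⟨h1, h2, h3, h10, h20, h11, h22, h13, h23, hp1, hp2⟩ := hd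
  have hg12 := hg.1
  have hg10 := hg.2.2.1
  have hα3 : d.α3 = 1 - d.α1 - d.α2 := rfl
  have h3' : 0 ≤ d.α3 := by linarith
  have hsq : g.g12 ^ 2 < g.g10 ^ 2 := pow_lt_pow_left₀ hlt hg12.le two_ne_zero
  have hn13 : 0 ≤ d.α3 * d.ρ13 := by positivity
  have hn10 : 0 ≤ d.α3 * d.ρ10 := by positivity
  have hn11 : 0 ≤ d.α1 * d.ρ11 := by positivity
  have hstep1 : d.α1 * cap (g.g12 ^ 2 * d.ρ11) ≤ d.α1 * cap (g.g10 ^ 2 * d.ρ11) :=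
    mul_le_mul_of_nonneg_left (cap_le_cap (by positivity)
      (mul_le_mul_of_nonneg_right hsq.le h11)) h1
  -- Concavity merges phases 1 and 3, and then spreads their energy over the whole unit of time.
  have hstep2 : d.α1 * cap (g.g10 ^ 2 * d.ρ11) + d.α3 * cap (g.g10 ^ 2 * d.ρ10) ≤
      cap (g.g10 ^ 2 * P1) := by
    rcases (add_nonneg h1 h3').eq_or_lt with h0 | h0
    · have e1 : d.α1 = 0 := by linarith
      have e3 : d.α3 = 0 := by linarith
      rw [e1, e3, zero_mul, zero_mul, add_zero]
      exact cap_nonneg (by positivity)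
    · have k1 := mul_cap_add_mul_cap_le h1 h3' h0 rfl (show 0 ≤ g.g10 ^ 2 * d.ρ11 by positivity)
        (show 0 ≤ g.g10 ^ 2 * d.ρ10 by positivity)
      have k2 := mul_cap_le h0.le (show d.α1 + d.α3 ≤ 1 by linarith) one_pos
        (show 0 ≤ (d.α1 * (g.g10 ^ 2 * d.ρ11) + d.α3 * (g.g10 ^ 2 * d.ρ10)) / (d.α1 + d.α3) by
          positivity)
      rw [mul_div_cancel₀ _ h0.ne', div_one, one_mul] at k2
      refine (k1.trans k2).trans (cap_le_cap (by positivity) ?_)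
      rw [← hp1]
      nlinarith [mul_nonneg (sq_nonneg g.g10) hn13]
  have hJ : d.J1 g = d.α1 * cap (g.g12 ^ 2 * d.ρ11) + d.α3 * cap (g.g10 ^ 2 * d.ρ10) := rfl
  refine ⟨by linarith, fun hle => ?_⟩
  -- Any energy in phase 1 would make replacing `g12` by `g10` a strict gain.
  have hz : d.α1 * d.ρ11 = 0 := by
    by_contra hne
    have hpos := hn11.lt_of_ne' hne
    have hα1 : 0 < d.α1 := h1.lt_of_ne' (left_ne_zero_of_mul hne)
    have hρ : 0 < d.ρ11 := h11.lt_of_ne' (right_ne_zero_of_mul hne)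
    have := mul_lt_mul_of_pos_left (cap_lt_cap (x := g.g12 ^ 2 * d.ρ11) (by positivity)
      (mul_lt_mul_of_pos_right hsq hρ)) hα1
    linarith
  have hz' : d.α1 * cap (g.g12 ^ 2 * d.ρ11) = 0 := by
    rcases mul_eq_zero.1 hz with h | h <;> simp [h, cap_zero]
  rw [hJ, hz', zero_add] at hle
  have hC : 0 < cap (g.g10 ^ 2 * P1) := cap_pos (by positivity)
  have hα3pos : 0 < d.α3 := by
    refine h3'.lt_of_ne' fun h => ?_
    rw [h, zero_mul] at hle
    linarith
  have hρ10 : 0 < d.ρ10 := by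
    refine h10.lt_of_ne' fun h => ?_
    rw [h, mul_zero, cap_zero, mul_zero] at hle
    linarith
  -- A shorter phase 3 would lose strictly, by strict concavity against zero power.
  have hα3one : d.α3 = 1 := by
    by_contra hne
    have hlt1 : d.α3 < 1 := lt_of_le_of_ne (by linarith) hne
    have k := mul_cap_lt hα3pos hlt1 (show 0 < g.g10 ^ 2 * d.ρ10 by positivity)
    have k2 : cap (d.α3 * (g.g10 ^ 2 * d.ρ10)) ≤ cap (g.g10 ^ 2 * P1) := by
      refine cap_le_cap (by positivity) ?_
      rw [← hp1, hz]
      nlinarith [mul_nonneg (sq_nonneg g.g10) hn13]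
    linarith
  rw [hα3one, one_mul] at hle
  rw [hz, hα3one] at hp1
  have hge : P1 ≤ d.ρ10 :=
    le_of_mul_le_mul_left ((cap_le_cap_iff (by positivity) (by positivity)).1 hle)
      (by positivity : 0 < g.g10 ^ 2)
  exact ⟨by linarith, by linarith, by linarith, by linarith⟩

/-- User 2's power `Q` is put into `ρ23`, where it enters only through `ζ` and can only relax the
bounds. -/
theorem direct_feasible_inRegion {g : Gains} (hg : g.Pos) {P1 Q : ℝ} (hP1 : 0 < P1)
    (hQ : 0 ≤ Q) :
    (⟨0, 0, P1, 0, 0, 0, 0, Q⟩ : Design).Feasible P1 Q ∧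
      (⟨0, 0, P1, 0, 0, 0, 0, Q⟩ : Design).InRegion g (cap (g.g10 ^ 2 * P1)) 0 := by
  have hg10 := hg.2.2.1
  have h0 : 0 ≤ cap (g.g10 ^ 2 * P1) := cap_nonneg (by positivity)
  have h1 : cap (g.g10 ^ 2 * P1) ≤ cap (g.g10 ^ 2 * P1 + g.g20 ^ 2 * Q) :=
    cap_le_cap (by positivity) (le_add_of_nonneg_right (by positivity))
  constructor
  · simp [Design.Feasible, Design.α3, hP1.le, hQ]
  · simp [Design.InRegion, Design.J1, Design.J2, Design.S1, Design.S2, Design.S3, Design.S4,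
      Design.I1, Design.I2, Design.I3, Design.I4, Design.I5, Design.I6, Design.I7, Design.I8,
      Design.ζ, Design.α3, cap_zero, h0, h1]

theorem usesScheme_direct {g : Gains} (hg : g.Pos) {P1 : ℝ} (hP1 : 0 < P1) :
    UsesScheme g ⟨0, 0, P1, 0, 0, 0, 0, 0⟩ (cap (g.g10 ^ 2 * P1)) IsDirect := by
  have hg10 := hg.2.2.1
  have h0 : 0 < cap (g.g10 ^ 2 * P1) := cap_pos (by positivity)
  refine ⟨⟨⟨cap (g.g10 ^ 2 * P1), 0, 0, 0⟩, ?_⟩, fun s hs => ?_⟩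
  · simp [Delivers, Decodable, Design.I1, Design.I2, Design.I3, Design.I4, Design.I5, Design.I6,
      Design.I7, Design.I8, Design.ζ, Design.α3, cap_zero, h0.le]
  · obtain ⟨⟨-, k12, -, -, k, -⟩, hR, h20, h21⟩ := hs
    have e12 : s.R12 = 0 := le_antisymm (by simpa [Design.I1] using k) k12
    have p10 : 0 < s.R10 := by linarith
    refine ⟨rfl, rfl, e12, ?_, rfl, rfl, rfl⟩
    ext m
    cases m <;> simp [sent13, Design.α3, RateSplit.rate, p10, hP1]

theorem direct_isGreatest {g : Gains} (hg : g.Pos) (hlt : g.g12 < g.g10) {P1 Q : ℝ}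
    (hP1 : 0 < P1) (hQ : 0 ≤ Q) :
    IsGreatest (individualRates g P1 Q) (cap (g.g10 ^ 2 * P1)) ∧
      ∀ d : Design, d.Feasible P1 Q → d.InRegion g (cap (g.g10 ^ 2 * P1)) 0 →
        d.α1 = 0 ∧ d.α2 = 0 ∧ d.ρ10 = P1 ∧ d.ρ13 = 0 := by
  refine ⟨⟨⟨_, direct_feasible_inRegion hg hP1 hQ⟩, ?_⟩, fun d hd hR =>
    (J1_le_cap hg hlt hP1 hd).2 hR.2.2.1⟩
  rintro R ⟨d, hd, hR⟩
  exact hR.2.2.1.trans (J1_le_cap hg hlt hP1 hd).1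

end RelayMAC

theorem theorem2 (g : Gains) (hg : g.Pos) (P1 P2 : ℝ) (hP1 : 0 < P1) (hP2 : 0 < P2) :
    -- If the inter-user link is weaker than the direct link, direct transmission is optimal
    -- over all phase durations and powers, whatever power `Q` user 2 spends.
    (g.g12 < g.g10 →
      (∀ Q : ℝ, 0 ≤ Q → Q ≤ P2 →
        IsGreatest (individualRates g P1 Q) (cap (g.g10 ^ 2 * P1)) ∧
        ∀ d : Design, d.Feasible P1 Q → d.InRegion g (cap (g.g10 ^ 2 * P1)) 0 →
          d.α1 = 0 ∧ d.α2 = 0 ∧ d.ρ10 = P1 ∧ d.ρ13 = 0) ∧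
      (⟨0, 0, P1, 0, 0, 0, 0, 0⟩ : Design).Feasible P1 0 ∧
      (⟨0, 0, P1, 0, 0, 0, 0, 0⟩ : Design).InRegion g (cap (g.g10 ^ 2 * P1)) 0 ∧
      UsesScheme g ⟨0, 0, P1, 0, 0, 0, 0, 0⟩ (cap (g.g10 ^ 2 * P1)) IsDirect) ∧
    -- Otherwise, for a fixed duration `α` of phase 1:
    (g.g10 ≤ g.g12 → ∀ α : ℝ, 0 < α → α < 1 →
      -- the relay problem has exactly one solution, and the KKT conditions characterize it;
      (∃! x : Point, IsOptimal g P1 P2 α x) ∧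
      (∀ x : Point, IsOptimal g P1 P2 α x ↔ ∃ m : Multipliers, IsKKT g P1 P2 α x m) ∧
      -- its value is the best individual rate of the three-phase scheme with this `α`;
      (∀ x : Point, IsOptimal g P1 P2 α x →
        (relayDesign P2 α x).Feasible P1 P2 ∧ (relayDesign P2 α x).InRegion g x.R 0 ∧
        IsGreatest (individualRatesAt g P1 P2 α) x.R) ∧
      -- the KKT solution determines the optimal scheme.
      (∀ (x : Point) (m : Multipliers), IsKKT g P1 P2 α x m →
        (Case2a m ∨ Case2b m ∨ Case3a m ∨ Case3b m) ∧
        (Case2a m → Case2aConclusion g P1 P2 α x m) ∧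
        (Case2b m → Case2bConclusion g P1 P2 α x m) ∧
        (Case3a m → Case3aConclusion g P1 P2 α x m) ∧
        (Case3b m → Case3bConclusion g P1 P2 α x m) ∧
        ((∀ y : Point, y.ValidPower P1 α → y.J1 g P2 α ≠ y.S4 g P2 α) →
          Case3a m ∨ Case3b m))) := by
  refine ⟨fun hlt => ⟨fun Q hQ _ => direct_isGreatest hg hlt hP1 hQ,
    (direct_feasible_inRegion hg hP1 le_rfl).1, (direct_feasible_inRegion hg hP1 le_rfl).2,
    usesScheme_direct hg hP1⟩, fun hle α hα0 hα => ⟨existsUnique_isOptimal hg hP1 hP2 hα0 hα,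
    fun x => ⟨fun h => h.exists_isKKT hg hP1 hP2 hα0 hα, fun ⟨m, h⟩ =>
      h.isOptimal hg hP2 hα0.le hα⟩,
    fun x h => h.isGreatest hg hP2 hα0 hα (h.rate_pos hg hP1 hP2 hα0 hα).le,
    fun x m h => ⟨?_, h.case2a hg hP1 hP2 hα0 hα hle, h.case2b hg hP1 hP2 hα0 hα,
      h.case3a hg hP1 hP2 hα0 hα hle, h.case3b hg hP1 hP2 hα0 hα, fun hne => ?_⟩⟩⟩
  · rcases h.2.2.2.1.eq_or_lt with h1 | h1 <;> rcases h.2.2.2.2.2.1.eq_or_lt with h2 | h2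
    · exact Or.inr (Or.inr (Or.inl ⟨h1.symm, h2.symm⟩))
    · exact Or.inr (Or.inr (Or.inr ⟨h1.symm, h2⟩))
    · exact Or.inl ⟨h1, h2.symm⟩
    · exact Or.inr (Or.inl ⟨h1, h2⟩)
  · have h1 : m.lam1 = 0 := by
      refine le_antisymm (not_lt.1 fun hm => ?_) h.2.2.2.1
      obtain ⟨y, hy, e⟩ := h.exists_J1_eq_S4 hg hP1 hP2 hα hm
      exact hne y hy e
    rcases h.2.2.2.2.2.1.eq_or_lt with h2 | h2
    · exact Or.inl ⟨h1, h2.symm⟩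
    · exact Or.inr ⟨h1, h2⟩
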